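/- Let $k$ be a field of characteristic $p\ge 3$. For super vector spaces $V,W$ (that is, $\mathbb Z/2$-graded $k$-vector spaces) let $\mathrm{Hom}(V,W)$ be the super vector space of all linear maps, and let $\boldsymbol\Gamma^d V\subseteq V^{\otimes d}$ be the subspace of invariants of the symmetric group $\Sigma_d$, where exchanging two adjacent homogeneous factors $v,w$ carries the sign $(-1)^{\overline v\,\overline w}$. Let $\boldsymbol\Gamma^d\boldsymbol{\mathcal V}$ be the category whose objects are the finite-dimensional super vector spaces and whose morphisms $V\to W$ are the elements of $\boldsymbol\Gamma^d\mathrm{Hom}(V,W)$, composed factor by factor with the Koszul sign. A homogeneous strict polynomial superfunctor of degree $d\ge 0$ is a functor $F$ from $\boldsymbol\Gamma^d\boldsymbol{\mathcal V}$ to super vector spaces such that all maps $\boldsymbol\Gamma^d\mathrm{Hom}(V,W)\to\mathrm{Hom}(F(V),F(W))$ are linear and even; its values may be finite- or infinite-dimensional. It is additive if for all $V,W$ the inclusions of the summands induce an isomorphism $F(V)\oplus F(W)\simeq F(V\oplus W)$, and nonzero if $F(V)\ne 0$ for some $V$. Let $\mathbf I$ be the identity superfunctor and let $\boldsymbol\Pi$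 be the parity change superfunctor, which exchanges the parities of a super vector space and sends a homogeneous linear map $\varphi$ to $(-1)^{\overline\varphi}\varphi$; both have degree $1$. For $r>0$ let $V^{(r)}=k\otimes_\varphi V$, where $\varphi(c)=c^{p^r}$, and let $\mathbf I^{(r)}$ be the superfunctor $V\mapsto V^{(r)}$ of degree $p^r$ whose action on morphisms is the composite $$\boldsymbol\Gamma^{p^r}\mathrm{Hom}(V,W)\longrightarrow \mathrm{Hom}(V,W)_0^{(r)}\simeq \mathrm{Hom}(V^{(r)},W^{(r)})_0 .$$ Here the first map is dual to the inclusion $\ell^{(r)}\mapsto \ell^{p^r}$ of the $r$-th twist of the dual space of $\mathrm{Hom}(V,W)$ into its $p^r$-th (super)symmetric power. Let $\mathbf I_0^{(r)},\mathbf I_1^{(r)}\subseteq\mathbf I^{(r)}$ be the subfunctors $V\mapsto V_0^{(r)}$ (placed in even degree) and $V\mapsto V_1^{(r)}$ (placed in odd degree). **Theorem.** Let $A$ be an additive homogeneous strict polynomial superfunctor of degree $d$. 1. If $A$ is nonzero, then $d=p^r$ for some integer $r\ge 0$. 2. If $d=1$, then $A$ is isomorphic, by an even natural isomorphism, to a direct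 sum of copies of $\mathbf I$ and $\boldsymbol\Pi$. 3. If $d=p^r$ with $r>0$, then $A$ is isomorphic, by an even natural isomorphism, to a direct sum of copies of $\mathbf I_0^{(r)}$, $\mathbf I_1^{(r)}$, $\mathbf I_0^{(r)}\circ\boldsymbol\Pi$ and $\mathbf I_1^{(r)}\circ\boldsymbol\Pi$. In (2) and (3) the direct sum may be infinite; it is finite if all values of $A$ are finite-dimensional. -/

import Mathlib

open scoped TensorProduct

universe u

namespace StrictPoly

/-- A super vector space: a `k`-vector space `V = V₀ ⊕ V₁` (of arbitrary dimension);
`gr 0` is the even part and `gr 1` is the odd part. -/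
structure SVec (k : Type u) [Field k] where
  carrier : Type u
  [addCommGroup : AddCommGroup carrier]
  [module : Module k carrier]
  gr : ZMod 2 → Submodule k carrier
  isCompl : IsCompl (gr 0) (gr 1)

attribute [instance] SVec.addCommGroup SVec.module

instance (k : Type u) [Field k] : CoeSort (SVec k) (Type u) := ⟨SVec.carrier⟩

/-- The sign `(-1)^c`. -/
def sgn (k : Type u) [Field k] (c : ZMod 2) : k := if c = 0 then 1 else -1

section Sgn

variable {k : Type u} [Field k]

theorem zmod2_cases (c : ZMod 2) : c = 0 ∨ c = 1 := by
  revert c; decide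

@[simp] theorem sgn_zero : sgn k 0 = 1 := by simp [sgn]

@[simp] theorem sgn_one : sgn k 1 = -1 := by simp [sgn]

theorem sgn_add (a b : ZMod 2) : sgn k (a + b) = sgn k a * sgn k b := by
  rcases zmod2_cases a with rfl | rfl <;> rcases zmod2_cases b with rfl | rfl <;>
    simp [sgn, show (1 + 1 : ZMod 2) = 0 from by decide]

@[simp] theorem sgn_mul_self (a : ZMod 2) : sgn k a * sgn k a = 1 := by
  rcases zmod2_cases a with rfl | rfl <;> simp

end Sgn

namespace SVec

variable {k : Type u} [Field k]

theorem isCompl' (V : SVec k) (c : ZMod 2) : IsCompl (V.gr c) (V.gr (c + 1)) := by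
  rcases zmod2_cases c with rfl | rfl
  · simpa using V.isCompl
  · simpa [show (1 + 1 : ZMod 2) = 0 from by decide] using V.isCompl.symm

/-- The projection of a super vector space onto its component of parity `c`. -/
noncomputable def proj (V : SVec k) (c : ZMod 2) : V →ₗ[k] V :=
  (V.gr c).projection (V.gr (c + 1)) (V.isCompl' c)

theorem proj_mem (V : SVec k) (c : ZMod 2) (v : V) : V.proj c v ∈ V.gr c :=
  Submodule.projection_apply_mem _ _

theorem proj_of_mem (V : SVec k) {a : ZMod 2} {v : V} (h : v ∈ V.gr a) (c : ZMod 2) :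
    V.proj c v = if c = a then v else 0 := by
  split_ifs with hc
  · subst hc
    exact Submodule.projection_apply_of_mem_left _ h
  · have : a = c + 1 := (by decide : ∀ a c : ZMod 2, ¬ c = a → a = c + 1) a c hc
    subst this
    exact Submodule.projection_apply_of_mem_right _ h

theorem sum_proj (V : SVec k) (v : V) : ∑ c, V.proj c v = v := by
  have : (∑ c : ZMod 2, V.proj c v) = V.proj 0 v + V.proj 1 v := Fin.sum_univ_two _
  rw [this]
  exact Submodule.projection_add_projection_eq_self V.isCompl v

theorem eq_zero_of_mem (V : SVec k) {a b : ZMod 2} (hab : a ≠ b) {v : V} (ha : v ∈ V.gr a)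
    (hb : v ∈ V.gr b) : v = 0 := by
  have h1 := V.proj_of_mem ha b
  have h2 := V.proj_of_mem hb b
  rw [if_neg (Ne.symm hab)] at h1
  rw [if_pos rfl] at h2
  rw [← h2, h1]

theorem proj_proj (V : SVec k) (a b : ZMod 2) (v : V) :
    V.proj a (V.proj b v) = if a = b then V.proj b v else 0 :=
  V.proj_of_mem (V.proj_mem b v) a

/-- A linear map is determined by its values on homogeneous vectors. -/
theorem hom_ext {V : SVec k} {M : Type*} [AddCommMonoid M] [Module k M] {f g : V →ₗ[k] M}
    (h : ∀ (a : ZMod 2) (v : V), v ∈ V.gr a → f v = g v) : f = g := by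
  ext v
  rw [← V.sum_proj v, map_sum, map_sum]
  exact Finset.sum_congr rfl fun a _ => h a _ (V.proj_mem a v)

/-- The super vector space of all linear maps `V → W`; a map has parity `c` when it sends
`V_a` into `W_{a+c}` for both `a`. -/
abbrev hom (V W : SVec k) : SVec k where
  carrier := V →ₗ[k] W
  gr c :=
    { carrier := {f | ∀ a, ∀ v ∈ V.gr a, f v ∈ W.gr (a + c)}
      add_mem' := fun hf hg a v hv => add_mem (hf a v hv) (hg a v hv)
      zero_mem' := fun _ _ _ => zero_mem _
      smul_mem' := fun r _ hf a v hv => Submodule.smul_mem _ r (hf a v hv) }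
  isCompl := by
    constructor
    · rw [Submodule.disjoint_def]
      intro f h0 h1
      ext v
      rw [← V.sum_proj v, map_sum]
      refine Finset.sum_eq_zero fun a _ => ?_
      exact W.eq_zero_of_mem (a := a + 0) (b := a + 1) (by revert a; decide)
        (h0 a _ (V.proj_mem a v)) (h1 a _ (V.proj_mem a v))
    · rw [codisjoint_iff, eq_top_iff]
      intro f _
      have hc : ∀ c : ZMod 2, (∑ a, W.proj (a + c) ∘ₗ f ∘ₗ V.proj a) ∈
          {f : V →ₗ[k] W | ∀ a, ∀ v ∈ V.gr a, f v ∈ W.gr (a + c)} := by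
        intro c a v hv
        rw [LinearMap.sum_apply]
        refine sum_mem fun b _ => ?_
        rw [LinearMap.comp_apply, LinearMap.comp_apply, V.proj_of_mem hv]
        split_ifs with h
        · subst h; exact W.proj_mem _ _
        · simp
      have : f = (∑ a, W.proj (a + 0) ∘ₗ f ∘ₗ V.proj a)
          + (∑ a, W.proj (a + 1) ∘ₗ f ∘ₗ V.proj a) := by
        rw [← Finset.sum_add_distrib]
        ext v
        rw [LinearMap.sum_apply]
        conv_lhs => rw [← V.sum_proj v, map_sum]
        refine Finset.sum_congr rfl fun a _ => ?_
        conv_lhs => rw [← W.sum_proj (f (V.proj a v))]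
        rcases zmod2_cases a with rfl | rfl
        · exact Fin.sum_univ_two _
        · refine (Fin.sum_univ_two _).trans ?_
          rw [add_comm]; rfl
      rw [this]
      exact Submodule.add_mem_sup (hc 0) (hc 1)

/-- The super vector space with exchanged parities. -/
abbrev pi (V : SVec k) : SVec k where
  carrier := V
  gr c := V.gr (c + 1)
  isCompl := by simpa [show (1 + 1 : ZMod 2) = 0 from by decide] using V.isCompl.symm

/-- The direct sum of two super vector spaces. -/
abbrev prod (V W : SVec k) : SVec k where
  carrier := V × W
  gr c := (V.gr c).prod (W.gr c)
  isCompl := by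
    constructor
    · rw [Submodule.disjoint_def]
      rintro ⟨v, w⟩ ⟨h1, h2⟩ ⟨h3, h4⟩
      exact Prod.ext (V.eq_zero_of_mem (by decide) h1 h3) (W.eq_zero_of_mem (by decide) h2 h4)
    · rw [codisjoint_iff, eq_top_iff]
      rintro ⟨v, w⟩ _
      have : (v, w) = (V.proj 0 v, W.proj 0 w) + (V.proj 1 v, W.proj 1 w) := by
        refine Prod.ext ?_ ?_
        · exact ((Fin.sum_univ_two _).symm.trans (V.sum_proj v)).symm
        · exact ((Fin.sum_univ_two _).symm.trans (W.sum_proj w)).symm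
      rw [this]
      exact Submodule.add_mem_sup ⟨V.proj_mem _ _, W.proj_mem _ _⟩ ⟨V.proj_mem _ _, W.proj_mem _ _⟩

theorem comp_mem {U V W : SVec k} {g : hom V W} {f : hom U V} {c b : ZMod 2}
    (hg : g ∈ (hom V W).gr c) (hf : f ∈ (hom U V).gr b) :
    (g ∘ₗ f : U →ₗ[k] W) ∈ (hom U W).gr (c + b) := by
  intro a v hv
  have := hg _ _ (hf a v hv)
  rwa [add_assoc, add_comm b c] at this

theorem id_mem (V : SVec k) : (LinearMap.id : V →ₗ[k] V) ∈ (hom V V).gr 0 := by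
  intro a v hv
  simpa using hv

end SVec

/-- The tensor power `E^{⊗ n}`. -/
abbrev TPow (k : Type u) [Field k] (n : ℕ) (E : Type u) [AddCommGroup E] [Module k E] : Type u :=
  ⨂[k] _ : Fin n, E

section Tensor

variable {k : Type u} [Field k] {n : ℕ}

/-- A linear map out of a tensor power is determined by the tensors of homogeneous vectors. -/
theorem TPow.hom_ext {V : SVec k} {M : Type*} [AddCommMonoid M] [Module k M]
    {f g : TPow k n V →ₗ[k] M}
    (h : ∀ (a : Fin n → ZMod 2) (v : Fin n → V), (∀ i, v i ∈ V.gr (a i)) →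
      f (PiTensorProduct.tprod k v) = g (PiTensorProduct.tprod k v)) : f = g := by
  refine PiTensorProduct.ext (MultilinearMap.ext fun v => ?_)
  have hv : v = fun i => ∑ c, V.proj c (v i) := funext fun i => (V.sum_proj (v i)).symm
  rw [hv, MultilinearMap.map_sum, MultilinearMap.map_sum]
  exact Finset.sum_congr rfl fun a _ => h a _ fun i => V.proj_mem _ _

/-- Permutation of tensor factors: `v₁ ⊗ ⋯ ⊗ vₙ ↦ v_{σ 1} ⊗ ⋯ ⊗ v_{σ n}`, without sign. -/
noncomputable def permute (V : SVec k) (σ : Equiv.Perm (Fin n)) : TPow k n V →ₗ[k] TPow k n V :=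
  PiTensorProduct.lift ((PiTensorProduct.tprod k).domDomCongr σ)

@[simp] theorem permute_tprod (V : SVec k) (σ : Equiv.Perm (Fin n)) (v : Fin n → V) :
    permute V σ (PiTensorProduct.tprod k v) = PiTensorProduct.tprod k fun i => v (σ i) := by
  simp [permute]

/-- The component of multidegree `a` of a tensor. -/
noncomputable def projT (V : SVec k) (a : Fin n → ZMod 2) : TPow k n V →ₗ[k] TPow k n V :=
  PiTensorProduct.map fun i => V.proj (a i)

theorem projT_tprod_of_mem (V : SVec k) (a b : Fin n → ZMod 2) {v : Fin n → V}
    (hv : ∀ i, v i ∈ V.gr (b i)) :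
    projT V a (PiTensorProduct.tprod k v) = if a = b then PiTensorProduct.tprod k v else 0 := by
  rw [projT, PiTensorProduct.map_tprod]
  split_ifs with h
  · subst h
    congr 1; funext i
    rw [V.proj_of_mem (hv i), if_pos rfl]
  · obtain ⟨i, hi⟩ := Function.ne_iff.mp h
    refine MultilinearMap.map_coord_zero _ i ?_
    rw [V.proj_of_mem (hv i), if_neg hi]

/-- The signed action of the transposition exchanging the places `i` and `j`. It is used for
adjacent places only, where on homogeneous vectors it exchanges `vᵢ` and `vⱼ` and multiplies by
`(-1)^{|vᵢ| |vⱼ|}`; see `signedSwap_tprod`. -/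
noncomputable def signedSwap (V : SVec k) (i j : Fin n) : TPow k n V →ₗ[k] TPow k n V :=
  ∑ a : Fin n → ZMod 2, sgn k (a i * a j) • permute V (Equiv.swap i j) ∘ₗ projT V a

theorem signedSwap_tprod (V : SVec k) (i j : Fin n) (a : Fin n → ZMod 2) {v : Fin n → V}
    (hv : ∀ l, v l ∈ V.gr (a l)) :
    signedSwap V i j (PiTensorProduct.tprod k v)
      = sgn k (a i * a j) • PiTensorProduct.tprod k fun l => v (Equiv.swap i j l) := by
  rw [signedSwap, LinearMap.sum_apply, Finset.sum_eq_single a]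
  · rw [LinearMap.smul_apply, LinearMap.comp_apply, projT_tprod_of_mem V _ _ hv, if_pos rfl,
      permute_tprod]
  · intro b _ hb
    rw [LinearMap.smul_apply, LinearMap.comp_apply, projT_tprod_of_mem V _ _ hv, if_neg hb]
    simp
  · simp

/-- `Γⁿ V`: the tensors in `V^{⊗ n}` that are invariant under the signed action of the symmetric
group, which is generated by the adjacent transpositions. -/
noncomputable def Gamma (n : ℕ) (V : SVec k) : Submodule k (TPow k n V) where
  carrier := {t | ∀ i j : Fin n, (i : ℕ) + 1 = j → signedSwap V i j t = t}
  add_mem' := fun hs ht i j h => by rw [map_add, hs i j h, ht i j h]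
  zero_mem' := fun i j _ => map_zero _
  smul_mem' := fun r _ ht i j h => by rw [map_smul, ht i j h]

theorem signedSwap_eq (V : SVec k) {i j : Fin n} (h : (i : ℕ) + 1 = j) (t : Gamma n V) :
    signedSwap V i j (t : TPow k n V) = t := t.2 i j h

/-- The tensors of total parity `c`. -/
def tensorGr (n : ℕ) (V : SVec k) (c : ZMod 2) : Submodule k (TPow k n V) :=
  Submodule.span k {t | ∃ (a : Fin n → ZMod 2) (v : Fin n → V),
    (∀ i, v i ∈ V.gr (a i)) ∧ ∑ i, a i = c ∧ t = PiTensorProduct.tprod k v}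

/-- The exponent of the Koszul sign in
`(g₁ ⊗ ⋯ ⊗ gₙ) ∘ (f₁ ⊗ ⋯ ⊗ fₙ) = ± g₁f₁ ⊗ ⋯ ⊗ gₙfₙ`, where `gᵢ` has parity `c i` and `fᵢ` has
parity `b i`: each `fᵢ` moves past all `gⱼ` with `i < j`. -/
def koszul (c b : Fin n → ZMod 2) : ZMod 2 :=
  ∑ i, ∑ j, if i < j then b i * c j else 0

/-- Composition of tensors of linear maps, with the Koszul sign. -/
noncomputable def compT (U V W : SVec k) :
    TPow k n (V.hom W) →ₗ[k] TPow k n (U.hom V) →ₗ[k] TPow k n (U.hom W) :=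
  ∑ c : Fin n → ZMod 2, ∑ b : Fin n → ZMod 2, sgn k (koszul c b) •
    (PiTensorProduct.map₂ fun _ => LinearMap.llcomp k U V W).compl₁₂
      (projT (V.hom W) c) (projT (U.hom V) b)

theorem compT_apply {U V W : SVec k} (y : TPow k n (V.hom W)) (x : TPow k n (U.hom V)) :
    compT U V W y x = ∑ c : Fin n → ZMod 2, ∑ b : Fin n → ZMod 2, sgn k (koszul c b) •
      PiTensorProduct.map₂ (fun _ => LinearMap.llcomp k U V W)
        (projT (V.hom W) c y) (projT (U.hom V) b x) := by
  simp only [compT, LinearMap.sum_apply, LinearMap.smul_apply, LinearMap.compl₁₂_apply]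

theorem compT_tprod {U V W : SVec k} (c b : Fin n → ZMod 2) {g : Fin n → V.hom W}
    {f : Fin n → U.hom V} (hg : ∀ i, g i ∈ (V.hom W).gr (c i))
    (hf : ∀ i, f i ∈ (U.hom V).gr (b i)) :
    compT U V W (PiTensorProduct.tprod k g) (PiTensorProduct.tprod k f)
      = sgn k (koszul c b) •
        PiTensorProduct.tprod k fun i => ((g i ∘ₗ f i : U →ₗ[k] W) : U.hom W) := by
  rw [compT_apply, Finset.sum_eq_single c, Finset.sum_eq_single b]
  · rw [projT_tprod_of_mem _ _ _ hg, projT_tprod_of_mem _ _ _ hf, if_pos rfl, if_pos rfl,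
      PiTensorProduct.map₂_tprod_tprod]
    rfl
  · intro b' _ hb
    rw [projT_tprod_of_mem _ _ _ hf, if_neg hb]
    simp
  · simp
  · intro c' _ hc
    refine Finset.sum_eq_zero fun b' _ => ?_
    rw [projT_tprod_of_mem _ _ _ hg, if_neg hc]
    simp
  · simp

/-- Exchanging two adjacent entries changes only one pair of the Koszul sign. -/
theorem koszul_swap (c b : Fin n → ZMod 2) {i j : Fin n} (h : (i : ℕ) + 1 = j) :
    koszul (fun l => c (Equiv.swap i j l)) (fun l => b (Equiv.swap i j l)) + b i * c j
      = koszul c b + b j * c i := by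
  have h1 : koszul (fun l => c (Equiv.swap i j l)) (fun l => b (Equiv.swap i j l))
      = ∑ x, ∑ y, if Equiv.swap i j x < Equiv.swap i j y then b x * c y else 0 := by
    unfold koszul
    rw [← Equiv.sum_comp (Equiv.swap i j)]
    refine Finset.sum_congr rfl fun x _ => ?_
    rw [← Equiv.sum_comp (Equiv.swap i j)]
    simp only [Equiv.swap_apply_self]
  have h2 : ∀ p q : Fin n, b p * c q = ∑ x, ∑ y, if x = p ∧ y = q then b x * c y else 0 := by
    intro p q
    rw [Finset.sum_eq_single p, Finset.sum_eq_single q]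
    · simp
    · intro y _ hy; simp [hy]
    · simp
    · intro x _ hx; simp [hx]
    · simp
  rw [h1, h2 i j, h2 j i, koszul, ← Finset.sum_add_distrib, ← Finset.sum_add_distrib]
  refine Finset.sum_congr rfl fun x _ => ?_
  rw [← Finset.sum_add_distrib, ← Finset.sum_add_distrib]
  refine Finset.sum_congr rfl fun y _ => ?_
  simp only [Equiv.swap_apply_def, Fin.lt_def, Fin.ext_iff]
  split_ifs <;> first | omega | simp

theorem signedSwap_compT {U V W : SVec k} {i j : Fin n} (h : (i : ℕ) + 1 = j)
    (y : TPow k n (V.hom W)) (x : TPow k n (U.hom V)) :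
    signedSwap (U.hom W) i j (compT U V W y x)
      = compT U V W (signedSwap (V.hom W) i j y) (signedSwap (U.hom V) i j x) := by
  have : (compT U V W).compr₂ (signedSwap (U.hom W) i j)
      = (compT U V W).compl₁₂ (signedSwap (V.hom W) i j) (signedSwap (U.hom V) i j) := by
    refine TPow.hom_ext fun c g hg => TPow.hom_ext fun b f hf => ?_
    rw [LinearMap.compr₂_apply, LinearMap.compl₁₂_apply, compT_tprod c b hg hf,
      signedSwap_tprod _ i j c hg, signedSwap_tprod _ i j b hf, map_smul, map_smul, map_smul,
      LinearMap.smul_apply,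
      signedSwap_tprod _ i j (fun l => c l + b l) (fun l => SVec.comp_mem (hg l) (hf l)),
      compT_tprod (fun l => c (Equiv.swap i j l)) (fun l => b (Equiv.swap i j l))
        (fun l => hg _) (fun l => hf _)]
    simp only [smul_smul, ← sgn_add]
    congr 2
    linear_combination -koszul_swap c b h + b i * c j * (by decide : (2 : ZMod 2) = 0)
  exact LinearMap.congr_fun₂ this y x

/-- The tensor `f ⊗ ⋯ ⊗ f` of an even vector `f`, as an element of `Γⁿ`. -/
noncomputable def Gamma.pow {V : SVec k} (f : V) (hf : f ∈ V.gr 0) : Gamma n V :=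
  ⟨PiTensorProduct.tprod k fun _ => f, fun i j _ => by
    rw [signedSwap_tprod V i j (fun _ => 0) (fun _ => hf)]; simp⟩

/-- The identity of `V` in the category whose morphisms `V → W` are `Γⁿ Hom(V, W)`. -/
noncomputable def Gamma.id (n : ℕ) (V : SVec k) : Gamma n (V.hom V) :=
  Gamma.pow LinearMap.id V.id_mem

/-- The composition in the category whose morphisms `V → W` are `Γⁿ Hom(V, W)`. -/
noncomputable def Gamma.comp {U V W : SVec k} (y : Gamma n (V.hom W)) (x : Gamma n (U.hom V)) :
    Gamma n (U.hom W) :=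
  ⟨compT U V W y x, fun i j h => by
    rw [signedSwap_compT h, signedSwap_eq _ h, signedSwap_eq _ h]⟩

theorem Gamma.id_comp {V W : SVec k} (x : Gamma n (V.hom W)) :
    Gamma.comp (Gamma.id n W) x = x := by
  refine Subtype.ext ?_
  have : compT V W W (PiTensorProduct.tprod k fun _ : Fin n => LinearMap.id)
      = LinearMap.id := by
    refine TPow.hom_ext fun a f hf => ?_
    rw [compT_tprod (fun _ => 0) a (fun _ => W.id_mem) hf]
    simp [koszul]
  exact LinearMap.congr_fun this x.1

theorem Gamma.comp_id {V W : SVec k} (x : Gamma n (V.hom W)) :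
    Gamma.comp x (Gamma.id n V) = x := by
  refine Subtype.ext ?_
  have : (compT V V W).flip (PiTensorProduct.tprod k fun _ : Fin n => LinearMap.id)
      = LinearMap.id := by
    refine TPow.hom_ext fun a f hf => ?_
    rw [LinearMap.flip_apply, compT_tprod a (fun _ => 0) hf (fun _ => V.id_mem)]
    simp [koszul]
  exact LinearMap.congr_fun this x.1

theorem koszul_add (c b a : Fin n → ZMod 2) :
    koszul c b + koszul (fun l => c l + b l) a = koszul b a + koszul c (fun l => b l + a l) := by
  simp only [koszul, ← Finset.sum_add_distrib]
  refine Finset.sum_congr rfl fun x _ => Finset.sum_congr rfl fun y _ => ?_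
  split_ifs
  · ring
  · simp

theorem compT_assoc {U V W X : SVec k} (z : TPow k n (W.hom X)) (y : TPow k n (V.hom W))
    (x : TPow k n (U.hom V)) :
    compT U V X (compT V W X z y) x = compT U W X z (compT U V W y x) := by
  have hz : (compT U V X).flip x ∘ₗ (compT V W X).flip y
      = (compT U W X).flip (compT U V W y x) := by
    refine TPow.hom_ext fun c h hh => ?_
    have hy : (compT U V X).flip x ∘ₗ compT V W X (PiTensorProduct.tprod k h)
        = compT U W X (PiTensorProduct.tprod k h) ∘ₗ (compT U V W).flip x := by
      refine TPow.hom_ext fun b g hg => ?_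
      have hx : compT U V X (compT V W X (PiTensorProduct.tprod k h) (PiTensorProduct.tprod k g))
          = compT U W X (PiTensorProduct.tprod k h) ∘ₗ
            compT U V W (PiTensorProduct.tprod k g) := by
        refine TPow.hom_ext fun a f hf => ?_
        rw [LinearMap.comp_apply, compT_tprod c b hh hg, compT_tprod b a hg hf, map_smul, map_smul,
          LinearMap.smul_apply,
          compT_tprod (fun l => c l + b l) a (fun l => SVec.comp_mem (hh l) (hg l)) hf,
          compT_tprod c (fun l => b l + a l) hh (fun l => SVec.comp_mem (hg l) (hf l)),
          smul_smul, smul_smul, ← sgn_add, ← sgn_add, koszul_add]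
        rfl
      exact LinearMap.congr_fun hx x
    exact LinearMap.congr_fun hy y
  exact LinearMap.congr_fun hz z

theorem Gamma.comp_assoc {U V W X : SVec k} (z : Gamma n (W.hom X)) (y : Gamma n (V.hom W))
    (x : Gamma n (U.hom V)) :
    Gamma.comp (Gamma.comp z y) x = Gamma.comp z (Gamma.comp y x) :=
  Subtype.ext (compT_assoc _ _ _)

/-- An even linear map `φ : V → W` induces `φ ⊗ ⋯ ⊗ φ : Γⁿ V → Γⁿ W`. -/
noncomputable def Gamma.map {V W : SVec k} (φ : V →ₗ[k] W) (hφ : φ ∈ (V.hom W).gr 0) :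
    Gamma n V →ₗ[k] Gamma n W :=
  LinearMap.restrict (PiTensorProduct.map fun _ => φ) fun t ht i j h => by
    have : signedSwap W i j ∘ₗ PiTensorProduct.map (fun _ => φ)
        = PiTensorProduct.map (fun _ => φ) ∘ₗ signedSwap V i j := by
      refine TPow.hom_ext fun a v hv => ?_
      have hv' : ∀ l, φ (v l) ∈ W.gr (a l) := fun l => by simpa using hφ _ _ (hv l)
      rw [LinearMap.comp_apply, LinearMap.comp_apply, PiTensorProduct.map_tprod,
        signedSwap_tprod W i j a hv', signedSwap_tprod V i j a hv, map_smul,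
        PiTensorProduct.map_tprod]
    rw [← LinearMap.comp_apply, this, LinearMap.comp_apply, ht i j h]

end Tensor

/-- A homogeneous strict polynomial superfunctor of degree `n` over `k`: an even superlinear
functor from the category whose objects are the finite-dimensional super vector spaces and whose
morphisms `V → W` are the elements of `Γⁿ Hom(V, W)`, to super vector spaces. Values may be
infinite-dimensional; see `HasFiniteDimensionalValues`. -/
structure StrictPolySuperfunctor (k : Type u) [Field k] (n : ℕ) where
  obj : ∀ (V : SVec k) [FiniteDimensional k V], SVec k
  map : ∀ {V W : SVec k} [FiniteDimensional k V] [FiniteDimensional k W],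
    Gamma n (V.hom W) →ₗ[k] (obj V).hom (obj W)
  map_id : ∀ (V : SVec k) [FiniteDimensional k V], map (Gamma.id n V) = LinearMap.id
  map_comp : ∀ {U V W : SVec k} [FiniteDimensional k U] [FiniteDimensional k V]
    [FiniteDimensional k W] (y : Gamma n (V.hom W)) (x : Gamma n (U.hom V)),
    map (Gamma.comp y x) = map y ∘ₗ map x
  map_even : ∀ {V W : SVec k} [FiniteDimensional k V] [FiniteDimensional k W] (c : ZMod 2)
    (t : Gamma n (V.hom W)), (t : TPow k n (V.hom W)) ∈ tensorGr n (V.hom W) c →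
    map t ∈ ((obj V).hom (obj W)).gr c

namespace StrictPolySuperfunctor

variable {k : Type u} [Field k] {n : ℕ}

def HasFiniteDimensionalValues (F : StrictPolySuperfunctor k n) : Prop :=
  ∀ (V : SVec k) [FiniteDimensional k V], FiniteDimensional k (F.obj V)

/-- `F` is nonzero: some value of `F` is a nonzero super vector space. -/
def IsNonzero (F : StrictPolySuperfunctor k n) : Prop :=
  ∃ (V : SVec k) (_ : FiniteDimensional k V), Nontrivial (F.obj V)

theorem inl_even (V W : SVec k) :
    (LinearMap.inl k V W : V →ₗ[k] V.prod W) ∈ (V.hom (V.prod W)).gr 0 := by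
  intro a v hv
  exact ⟨by simpa using hv, zero_mem _⟩

theorem inr_even (V W : SVec k) :
    (LinearMap.inr k V W : W →ₗ[k] V.prod W) ∈ (W.hom (V.prod W)).gr 0 := by
  intro a v hv
  exact ⟨zero_mem _, by simpa using hv⟩

/-- The map `F(V) → F(V ⊕ W)` induced by the inclusion of the first summand. -/
noncomputable def mapInl (F : StrictPolySuperfunctor k n) (V W : SVec k) [FiniteDimensional k V]
    [FiniteDimensional k W] : F.obj V →ₗ[k] F.obj (V.prod W) :=
  F.map (Gamma.pow (LinearMap.inl k V W) (inl_even V W))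

/-- The map `F(W) → F(V ⊕ W)` induced by the inclusion of the second summand. -/
noncomputable def mapInr (F : StrictPolySuperfunctor k n) (V W : SVec k) [FiniteDimensional k V]
    [FiniteDimensional k W] : F.obj W →ₗ[k] F.obj (V.prod W) :=
  F.map (Gamma.pow (LinearMap.inr k V W) (inr_even V W))

/-- `F` is additive: the inclusions induce an isomorphism `F(V) ⊕ F(W) ≃ F(V ⊕ W)`. -/
def IsAdditive (F : StrictPolySuperfunctor k n) : Prop :=
  ∀ (V W : SVec k) [FiniteDimensional k V] [FiniteDimensional k W],
    Function.Bijective ((F.mapInl V W).coprod (F.mapInr V W))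

/-- An even natural isomorphism `F ≃ G`. For an even transformation the naturality square
commutes without sign. -/
structure Iso (F G : StrictPolySuperfunctor k n) where
  equiv : ∀ (V : SVec k) [FiniteDimensional k V], F.obj V ≃ₗ[k] G.obj V
  even : ∀ (V : SVec k) [FiniteDimensional k V] (c : ZMod 2) (x : F.obj V),
    x ∈ (F.obj V).gr c → equiv V x ∈ (G.obj V).gr c
  natural : ∀ {V W : SVec k} [FiniteDimensional k V] [FiniteDimensional k W]
    (t : Gamma n (V.hom W)) (x : F.obj V), equiv W (F.map t x) = G.map t (equiv V x)

/-- The direct sum of a family of super vector spaces. -/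
abbrev _root_.StrictPoly.SVec.directSum {ι : Type u} (V : ι → SVec k) : SVec k where
  carrier := DirectSum ι fun i => V i
  gr c :=
    { carrier := {x | ∀ i, x i ∈ (V i).gr c}
      add_mem' := fun hx hy i => add_mem (hx i) (hy i)
      zero_mem' := fun _ => zero_mem _
      smul_mem' := fun r _ hx i => Submodule.smul_mem _ r (hx i) }
  isCompl := by
    constructor
    · rw [Submodule.disjoint_def]
      intro x h0 h1
      exact DFinsupp.ext fun i => (V i).eq_zero_of_mem (by decide) (h0 i) (h1 i)
    · rw [codisjoint_iff, eq_top_iff]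
      intro x _
      have : x = DirectSum.lmap (fun i => (V i).proj 0) x
          + DirectSum.lmap (fun i => (V i).proj 1) x :=
        DFinsupp.ext fun i => ((Fin.sum_univ_two _).symm.trans ((V i).sum_proj (x i))).symm
      rw [this]
      exact Submodule.add_mem_sup (fun i => (V i).proj_mem _ _) (fun i => (V i).proj_mem _ _)

/-- The direct sum of a family of superfunctors of the same degree. -/
noncomputable def directSum {ι : Type u} (G : ι → StrictPolySuperfunctor k n) :
    StrictPolySuperfunctor k n where
  obj V _ := SVec.directSum fun i => (G i).obj V
  map {V W} _ _ :=
    { toFun := fun t => DirectSum.lmap fun i => (G i).map t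
      map_add' := fun s t => LinearMap.ext fun x => DFinsupp.ext fun i => by
        simp only [map_add]; rfl
      map_smul' := fun r t => LinearMap.ext fun x => DFinsupp.ext fun i => by
        simp only [map_smul]; rfl }
  map_id V _ := LinearMap.ext fun x => DFinsupp.ext fun i => by
    change (G i).map (Gamma.id n V) (x i) = x i
    rw [(G i).map_id]; rfl
  map_comp y x := LinearMap.ext fun v => DFinsupp.ext fun i => by
    change (G i).map (Gamma.comp y x) (v i) = (G i).map y ((G i).map x (v i))
    rw [(G i).map_comp]; rfl
  map_even c t ht a x hx i := (G i).map_even c t ht a (x i) (hx i)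

/-- The canonical identification `V^{⊗ 1} = V`. -/
noncomputable def fromOne (V : SVec k) : TPow k 1 V →ₗ[k] V :=
  (PiTensorProduct.subsingletonEquiv (0 : Fin 1)).toLinearMap

@[simp] theorem fromOne_tprod (V : SVec k) (v : Fin 1 → V) :
    fromOne V (PiTensorProduct.tprod k v) = v 0 := by
  simp [fromOne]

theorem fromOne_compT {U V W : SVec k} (y : TPow k 1 (V.hom W)) (x : TPow k 1 (U.hom V)) :
    fromOne (U.hom W) (compT U V W y x)
      = (fromOne (V.hom W) y : V →ₗ[k] W) ∘ₗ (fromOne (U.hom V) x : U →ₗ[k] V) := by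
  have : (compT U V W).compr₂ (fromOne (U.hom W))
      = (LinearMap.llcomp k U V W).compl₁₂ (fromOne (V.hom W)) (fromOne (U.hom V)) := by
    refine TPow.hom_ext fun c g hg => TPow.hom_ext fun b f hf => ?_
    rw [LinearMap.compr₂_apply, LinearMap.compl₁₂_apply, compT_tprod c b hg hf, map_smul,
      fromOne_tprod, fromOne_tprod, fromOne_tprod]
    simp [koszul]
    rfl
  exact LinearMap.congr_fun₂ this y x

theorem fromOne_mem (V : SVec k) (c : ZMod 2) (t : TPow k 1 V) (ht : t ∈ tensorGr 1 V c) :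
    fromOne V t ∈ V.gr c := by
  have : tensorGr 1 V c ≤ (V.gr c).comap (fromOne V) := by
    refine Submodule.span_le.mpr ?_
    rintro _ ⟨a, v, hv, rfl, rfl⟩
    simpa using hv 0
  exact this ht

/-- The identity superfunctor `𝐈`, of degree `1`. -/
noncomputable def identity (k : Type u) [Field k] : StrictPolySuperfunctor k 1 where
  obj V _ := V
  map {V W} _ _ := fromOne (V.hom W) ∘ₗ (Gamma 1 (V.hom W)).subtype
  map_id _ _ := fromOne_tprod _ _
  map_comp _ _ := fromOne_compT _ _
  map_even c _ ht := fromOne_mem _ c _ ht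

/-- The linear map `v ↦ (-1)^{|v|} v`. -/
noncomputable def sg (V : SVec k) : V →ₗ[k] V := V.proj 0 - V.proj 1

theorem sg_of_mem (V : SVec k) {c : ZMod 2} {v : V} (hv : v ∈ V.gr c) :
    sg V v = sgn k c • v := by
  rw [sg, LinearMap.sub_apply, V.proj_of_mem hv, V.proj_of_mem hv]
  rcases zmod2_cases c with rfl | rfl <;> simp

theorem pi_hom_gr (V W : SVec k) (c : ZMod 2) : (V.pi.hom W.pi).gr c = (V.hom W).gr c := by
  ext f
  constructor
  · intro hf a v hv
    have := hf (a + 1) v (by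
      change v ∈ V.gr (a + 1 + 1)
      rwa [add_assoc, show (1 + 1 : ZMod 2) = 0 from by decide, add_zero])
    change f v ∈ W.gr (a + 1 + c + 1) at this
    rwa [(by decide : ∀ a c : ZMod 2, a + 1 + c + 1 = a + c) a c] at this
  · intro hf a v hv
    have := hf (a + 1) v hv
    change f v ∈ W.gr (a + c + 1)
    rwa [show a + c + 1 = a + 1 + c from by ring]

/-- The action `φ ↦ (-1)^{|φ|} φ` of `𝚷` on linear maps. -/
noncomputable def piHom (V W : SVec k) : V.hom W →ₗ[k] V.pi.hom W.pi := sg (V.hom W)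

theorem piHom_of_mem (V W : SVec k) {c : ZMod 2} {f : V.hom W} (hf : f ∈ (V.hom W).gr c) :
    piHom V W f = sgn k c • (f : V →ₗ[k] W) := sg_of_mem _ hf

theorem piHom_mem (V W : SVec k) {c : ZMod 2} {f : V.hom W} (hf : f ∈ (V.hom W).gr c) :
    piHom V W f ∈ (V.pi.hom W.pi).gr c := by
  rw [piHom_of_mem V W hf, pi_hom_gr]
  exact Submodule.smul_mem _ _ hf

theorem piHom_even (V W : SVec k) : piHom V W ∈ ((V.hom W).hom (V.pi.hom W.pi)).gr 0 := by
  intro a f hf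
  rw [add_zero]
  exact piHom_mem V W hf

theorem piHom_comp {U V W : SVec k} (g : V →ₗ[k] W) (f : U →ₗ[k] V) :
    piHom U W (g ∘ₗ f) = (piHom V W g : V.pi →ₗ[k] W.pi) ∘ₗ (piHom U V f : U.pi →ₗ[k] V.pi) := by
  have : (LinearMap.llcomp k U V W).compr₂ (piHom U W)
      = (LinearMap.llcomp k U.pi V.pi W.pi).compl₁₂ (piHom V W) (piHom U V) := by
    refine SVec.hom_ext (V := V.hom W) fun c g hg => SVec.hom_ext (V := U.hom V) fun b f hf => ?_
    change piHom U W (g ∘ₗ f) = (piHom V W g : V.pi →ₗ[k] W.pi) ∘ₗ (piHom U V f : U.pi →ₗ[k] V.pi)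
    rw [piHom_of_mem U W (SVec.comp_mem hg hf), piHom_of_mem V W hg, piHom_of_mem U V hf,
      LinearMap.smul_comp, LinearMap.comp_smul, smul_smul, sgn_add]
  exact LinearMap.congr_fun₂ this g f

theorem map_piHom_compT {U V W : SVec k} (y : TPow k n (V.hom W)) (x : TPow k n (U.hom V)) :
    PiTensorProduct.map (fun _ => piHom U W) (compT U V W y x)
      = compT U.pi V.pi W.pi (PiTensorProduct.map (fun _ => piHom V W) y)
        (PiTensorProduct.map (fun _ => piHom U V) x) := by
  have : (compT U V W).compr₂ (PiTensorProduct.map fun _ : Fin n => piHom U W)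
      = (compT U.pi V.pi W.pi).compl₁₂ (PiTensorProduct.map fun _ => piHom V W)
        (PiTensorProduct.map fun _ => piHom U V) := by
    refine TPow.hom_ext fun c g hg => TPow.hom_ext fun b f hf => ?_
    rw [LinearMap.compr₂_apply, LinearMap.compl₁₂_apply, compT_tprod c b hg hf, map_smul,
      PiTensorProduct.map_tprod, PiTensorProduct.map_tprod, PiTensorProduct.map_tprod,
      compT_tprod c b (fun i => piHom_mem _ _ (hg i)) (fun i => piHom_mem _ _ (hf i))]
    congr 2; funext i
    exact piHom_comp _ _
  exact LinearMap.congr_fun₂ this y x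

/-- The parity change superfunctor `𝚷`, of degree `1`. -/
noncomputable def parityChange (k : Type u) [Field k] : StrictPolySuperfunctor k 1 where
  obj V _ := V.pi
  map {V W} _ _ := piHom V W ∘ₗ fromOne (V.hom W) ∘ₗ (Gamma 1 (V.hom W)).subtype
  map_id V _ := by
    change piHom V V (fromOne _ (PiTensorProduct.tprod k _)) = _
    rw [fromOne_tprod, piHom_of_mem V V V.id_mem]
    simp
  map_comp {U V W} _ _ _ y x := by
    change piHom U W (fromOne (U.hom W) (compT U V W y x)) = _
    rw [fromOne_compT, piHom_comp]
    rfl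
  map_even c t ht := piHom_mem _ _ (fromOne_mem _ c _ ht)

/-- The action of `𝚷` on `Γⁿ Hom(V, W)`. -/
noncomputable def gammaPi {V W : SVec k} :
    Gamma n (V.hom W) →ₗ[k] Gamma n (V.pi.hom W.pi) :=
  Gamma.map (piHom V W) (piHom_even V W)

theorem gammaPi_coe {V W : SVec k} (t : Gamma n (V.hom W)) :
    (gammaPi t : TPow k n (V.pi.hom W.pi)) = PiTensorProduct.map (fun _ => piHom V W) t.1 := rfl

theorem gammaPi_id (V : SVec k) : gammaPi (Gamma.id n V) = Gamma.id n V.pi := by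
  refine Subtype.ext ?_
  change PiTensorProduct.map _ (PiTensorProduct.tprod k _) = PiTensorProduct.tprod k _
  rw [PiTensorProduct.map_tprod]
  congr 1; funext i
  rw [piHom_of_mem V V V.id_mem]
  simp

theorem gammaPi_comp {U V W : SVec k} (y : Gamma n (V.hom W)) (x : Gamma n (U.hom V)) :
    gammaPi (Gamma.comp y x) = Gamma.comp (gammaPi y) (gammaPi x) := by
  refine Subtype.ext ?_
  rw [gammaPi_coe]
  exact map_piHom_compT y.1 x.1

theorem gammaPi_mem {V W : SVec k} (c : ZMod 2) (t : Gamma n (V.hom W))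
    (ht : t.1 ∈ tensorGr n (V.hom W) c) : (gammaPi t).1 ∈ tensorGr n (V.pi.hom W.pi) c := by
  have : tensorGr n (V.hom W) c ≤ (tensorGr n (V.pi.hom W.pi) c).comap
      (PiTensorProduct.map fun _ => piHom V W) := by
    refine Submodule.span_le.mpr ?_
    rintro _ ⟨a, v, hv, hc, rfl⟩
    refine Submodule.subset_span
      ⟨a, fun i => piHom V W (v i), fun i => piHom_mem _ _ (hv i), hc, ?_⟩
    rw [PiTensorProduct.map_tprod]
  exact this ht

/-- The composite `F ∘ 𝚷`: it sends `V` to `F(𝚷 V)`, and a morphism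
`t ∈ Γⁿ Hom(V, W)` to the value of `F` on its image in `Γⁿ Hom(𝚷 V, 𝚷 W)`. -/
noncomputable def compPi (F : StrictPolySuperfunctor k n) : StrictPolySuperfunctor k n where
  obj V _ := F.obj V.pi
  map {V W} _ _ := F.map (V := V.pi) (W := W.pi) ∘ₗ gammaPi
  map_id V _ := by rw [LinearMap.comp_apply, gammaPi_id, F.map_id]
  map_comp y x := by
    rw [LinearMap.comp_apply, LinearMap.comp_apply, LinearMap.comp_apply, gammaPi_comp, F.map_comp]
  map_even c t ht := F.map_even c _ (gammaPi_mem c t ht)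

/-- The component of parity `c` of a super vector space, concentrated in parity `c`. -/
abbrev _root_.StrictPoly.SVec.part (V : SVec k) (c : ZMod 2) : SVec k where
  carrier := V.gr c
  gr b := if b = c then ⊤ else ⊥
  isCompl := by
    rcases zmod2_cases c with rfl | rfl
    · simpa using isCompl_top_bot
    · simpa using isCompl_bot_top

/-- The restriction to the components of parity `c` of an even linear map. -/
def restrictPart {V W : SVec k} (c : ZMod 2) (f : V →ₗ[k] W) (hf : f ∈ (V.hom W).gr 0) :
    V.part c →ₗ[k] W.part c :=
  f.restrict fun v hv => by simpa using hf c v hv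

theorem restrictPart_mem {V W : SVec k} (c : ZMod 2) (f : V →ₗ[k] W) (hf : f ∈ (V.hom W).gr 0) :
    restrictPart c f hf ∈ ((V.part c).hom (W.part c)).gr 0 := by
  intro a v hv
  change v ∈ (if a = c then ⊤ else ⊥ : Submodule k (V.gr c)) at hv
  change _ ∈ (if a + 0 = c then ⊤ else ⊥ : Submodule k (W.gr c))
  rw [add_zero]
  split_ifs with h
  · trivial
  · rw [if_neg h] at hv
    rw [(Submodule.mem_bot k).mp hv, map_zero]
    exact zero_mem _

/-- For a superfunctor `F` all of whose maps are even, the subfunctor `V ↦ F(V)_c`, which is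
concentrated in parity `c`. -/
noncomputable def parityPart (F : StrictPolySuperfunctor k n)
    (hF : ∀ (V W : SVec k) [FiniteDimensional k V] [FiniteDimensional k W]
      (t : Gamma n (V.hom W)), F.map t ∈ ((F.obj V).hom (F.obj W)).gr 0) (c : ZMod 2) :
    StrictPolySuperfunctor k n where
  obj V _ := (F.obj V).part c
  map {V W} _ _ :=
    { toFun := fun t => restrictPart c (F.map t) (hF V W t)
      map_add' := fun s t => LinearMap.ext fun x => Subtype.ext <| by
        change F.map (s + t) x.1 = F.map s x.1 + F.map t x.1
        rw [map_add]; rfl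
      map_smul' := fun r t => LinearMap.ext fun x => Subtype.ext <| by
        change F.map (r • t) x.1 = r • F.map t x.1
        rw [map_smul]; rfl }
  map_id V _ := LinearMap.ext fun x => Subtype.ext <| by
    change F.map (Gamma.id n V) x.1 = x.1
    rw [F.map_id]; rfl
  map_comp y x := LinearMap.ext fun v => Subtype.ext <| by
    change F.map (Gamma.comp y x) v.1 = F.map y (F.map x v.1)
    rw [F.map_comp]; rfl
  map_even {V W} _ _ b t ht := by
    rcases zmod2_cases b with rfl | rfl
    · exact restrictPart_mem c _ (hF V W t)
    · have h0 : F.map t = 0 :=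
        SVec.eq_zero_of_mem _ (by decide) (hF V W t) (F.map_even 1 t ht)
      have : restrictPart c (F.map t) (hF V W t) = 0 :=
        LinearMap.ext fun x => Subtype.ext <| by
          change F.map t x.1 = 0
          rw [h0]; rfl
      change restrictPart c (F.map t) (hF V W t) ∈ _
      rw [this]
      exact zero_mem _

end StrictPolySuperfunctor

section Frobenius

variable (k : Type u) [Field k] (p r : ℕ) [Fact p.Prime] [CharP k p]

/-- The field `k`, regarded as a `k`-algebra through the `p^r`-th power map. -/
def FrobScalars (k : Type u) (_p _r : ℕ) : Type u := k

noncomputable instance : CommRing (FrobScalars k p r) := inferInstanceAs (CommRing k)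

noncomputable instance : Algebra k (FrobScalars k p r) :=
  (iterateFrobenius k p r : k →+* k).toAlgebra

/-- The vector space `k ⊗_φ V`, where `φ` is the `p^r`-th power map of `k`; here `k` acts by
multiplication on the left factor. -/
def FrobTwist (V : Type u) [AddCommGroup V] [Module k V] : Type u := FrobScalars k p r ⊗[k] V

variable {V W : Type u} [AddCommGroup V] [Module k V] [AddCommGroup W] [Module k W]

noncomputable instance : AddCommGroup (FrobTwist k p r V) :=
  inferInstanceAs (AddCommGroup (FrobScalars k p r ⊗[k] V))

noncomputable instance : Module k (FrobTwist k p r V) :=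
  inferInstanceAs (Module (FrobScalars k p r) (FrobScalars k p r ⊗[k] V))

namespace FrobTwist

/-- The element `v^{(r)} = 1 ⊗ v`. -/
noncomputable def mk (v : V) : FrobTwist k p r V := (1 : FrobScalars k p r) ⊗ₜ[k] v

theorem smul_tmul_aux (c d : FrobScalars k p r) (v : V) :
    c • (d ⊗ₜ[k] v) = (c * d) ⊗ₜ[k] v := rfl

theorem smul_mk (c : k) (v : V) :
    c • mk k p r v = ((c : FrobScalars k p r) ⊗ₜ[k] v : FrobScalars k p r ⊗[k] V) := by
  exact (smul_tmul_aux k p r c 1 v).trans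
    (congrArg (fun d : FrobScalars k p r => d ⊗ₜ[k] v) (mul_one (M := FrobScalars k p r) c))

theorem mk_add (v w : V) : mk k p r (v + w) = mk k p r v + mk k p r w :=
  TensorProduct.tmul_add _ _ _

theorem mk_smul (c : k) (v : V) : mk k p r (c • v) = c ^ p ^ r • mk k p r v := by
  rw [smul_mk]
  change (1 : FrobScalars k p r) ⊗ₜ[k] (c • v) = _
  rw [← TensorProduct.smul_tmul, Algebra.smul_def, mul_one]
  rfl

variable {k p r}

theorem induction {P : FrobTwist k p r V → Prop} (h0 : P 0)
    (h1 : ∀ (c : k) (v : V), P (c • mk k p r v)) (h2 : ∀ x y, P x → P y → P (x + y))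
    (x : FrobTwist k p r V) : P x := by
  refine TensorProduct.induction_on (motive := P) x h0 (fun c v => ?_) h2
  exact smul_mk k p r c v ▸ h1 c v

theorem hom_ext {M : Type*} [AddCommGroup M] [Module k M] {f g : FrobTwist k p r V →ₗ[k] M}
    (h : ∀ v, f (mk k p r v) = g (mk k p r v)) : f = g := by
  refine LinearMap.ext fun x => ?_
  induction x using induction with
  | h0 => simp
  | h1 c v => rw [map_smul, map_smul, h]
  | h2 x y hx hy => rw [map_add, map_add, hx, hy]

/-- The biadditive map `(c, v) ↦ c f(v)`. -/
def liftAux {M : Type*} [AddCommGroup M] [Module k M] (f : V →+ M) :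
    FrobScalars k p r →+ V →+ M :=
  (((smulAddHom k M).flip.comp f).flip : k →+ V →+ M)

/-- The additive map `c ⊗ v ↦ c f(v)`. -/
noncomputable def liftAdd {M : Type*} [AddCommGroup M] [Module k M] (f : V →+ M)
    (hf : ∀ (c : k) (v : V), f (c • v) = c ^ p ^ r • f v) : FrobTwist k p r V →+ M :=
  TensorProduct.liftAddHom (R := k) (M := FrobScalars k p r) (N := V) (P := M)
    (liftAux f) (fun s c v => by
      have h : ∀ a : k, (s ^ p ^ r * a) • f v = a • f (s • v) := fun a => by
        rw [hf, smul_smul, mul_comm]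
      exact h c)

theorem liftAdd_smul_mk {M : Type*} [AddCommGroup M] [Module k M] (f : V →+ M)
    (hf : ∀ (c : k) (v : V), f (c • v) = c ^ p ^ r • f v) (c : k) (v : V) :
    liftAdd f hf (c • mk k p r v) = c • f v := by
  rw [smul_mk]; rfl

/-- Extension of a `φ`-semilinear map `V → M` to a linear map `k ⊗_φ V → M`. -/
noncomputable def lift {M : Type*} [AddCommGroup M] [Module k M] (f : V →+ M)
    (hf : ∀ (c : k) (v : V), f (c • v) = c ^ p ^ r • f v) : FrobTwist k p r V →ₗ[k] M where
  toFun := liftAdd f hf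
  map_add' := map_add _
  map_smul' c x := by
    induction x using induction with
    | h0 => simp
    | h1 d v =>
      rw [smul_smul, liftAdd_smul_mk, liftAdd_smul_mk, mul_smul]; rfl
    | h2 x y hx hy => rw [smul_add, map_add, hx, hy, map_add, smul_add]

@[simp] theorem lift_mk {M : Type*} [AddCommGroup M] [Module k M] (f : V →+ M)
    (hf : ∀ (c : k) (v : V), f (c • v) = c ^ p ^ r • f v) (v : V) :
    lift f hf (mk k p r v) = f v :=
  one_smul k (f v)

variable (k p r) in
/-- `v ↦ 1 ⊗ v` as an additive map. -/
noncomputable def mkHom : V →+ FrobTwist k p r V :=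
  AddMonoidHom.mk' (mk k p r) (mk_add k p r)

variable (p r) in
/-- The twist `f^{(r)}` of a linear map, `f^{(r)}(v^{(r)}) = f(v)^{(r)}`. -/
noncomputable def map (f : V →ₗ[k] W) : FrobTwist k p r V →ₗ[k] FrobTwist k p r W :=
  lift ((mkHom k p r).comp f.toAddMonoidHom) fun c v => by
    change mk k p r (f (c • v)) = c ^ p ^ r • mk k p r (f v)
    rw [map_smul, mk_smul]

@[simp] theorem map_mk (f : V →ₗ[k] W) (v : V) :
    map p r f (mk k p r v) = mk k p r (f v) := lift_mk _ _ _

variable (p r) in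
/-- The linear map `k ⊗_φ Hom(V, W) → Hom(k ⊗_φ V, k ⊗_φ W)` with `f^{(r)} ↦ f^{(r)}`. -/
noncomputable def homMap :
    FrobTwist k p r (V →ₗ[k] W) →ₗ[k] FrobTwist k p r V →ₗ[k] FrobTwist k p r W :=
  lift (AddMonoidHom.mk' (map p r) fun f g => hom_ext fun v => by
      rw [LinearMap.add_apply, map_mk, map_mk, map_mk, LinearMap.add_apply, mk_add])
    fun c f => hom_ext fun v => by
      change map p r (c • f) (mk k p r v) = c ^ p ^ r • map p r f (mk k p r v)
      rw [map_mk, map_mk, LinearMap.smul_apply, mk_smul]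

@[simp] theorem homMap_mk (f : V →ₗ[k] W) : homMap p r (mk k p r f) = map p r f := lift_mk _ _ _

variable (p r) in
/-- The linear form `c ⊗ v ↦ c ℓ(v)^{p^r}`. -/
noncomputable def form (l : V →ₗ[k] k) : FrobTwist k p r V →ₗ[k] k :=
  lift ((iterateFrobenius k p r).toAddMonoidHom.comp l.toAddMonoidHom) fun c v => by
    change iterateFrobenius k p r (l (c • v)) = c ^ p ^ r • iterateFrobenius k p r (l v)
    rw [map_smul, smul_eq_mul, map_mul, iterateFrobenius_def, smul_eq_mul]

@[simp] theorem form_mk (l : V →ₗ[k] k) (v : V) : form p r l (mk k p r v) = l v ^ p ^ r :=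
  lift_mk _ _ _

theorem mk_sum {ι : Type*} (s : Finset ι) (v : ι → V) :
    mk k p r (∑ i ∈ s, v i) = ∑ i ∈ s, mk k p r (v i) :=
  map_sum (mkHom k p r) v s

theorem eq_sum_basis {ι : Type*} [Fintype ι] (b : Module.Basis ι k V) (x : FrobTwist k p r V) :
    x = ∑ i, form p r (b.coord i) x • mk k p r (b i) := by
  have : LinearMap.id = ∑ i, (form p r (b.coord i)).smulRight (mk k p r (b i)) := by
    refine hom_ext fun v => ?_
    simp only [LinearMap.id_apply, LinearMap.sum_apply, LinearMap.smulRight_apply, form_mk]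
    conv_lhs => rw [← b.sum_repr v, mk_sum]
    simp only [mk_smul, Module.Basis.coord_apply]
  conv_lhs => rw [← LinearMap.id_apply (R := k) x, this]
  simp only [LinearMap.sum_apply, LinearMap.smulRight_apply]

/-- Linear forms of the shape `form l` separate the points of the twist of a finite-dimensional
space. -/
theorem ext_form [FiniteDimensional k V] {x y : FrobTwist k p r V}
    (h : ∀ l : V →ₗ[k] k, form p r l x = form p r l y) : x = y := by
  rw [eq_sum_basis (Module.finBasis k V) x, eq_sum_basis (Module.finBasis k V) y]
  simp only [h]

end FrobTwist

variable {k}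

/-- The Frobenius twist `V^{(r)}` of a super vector space, with even part `V₀^{(r)}` and odd part
`V₁^{(r)}`. -/
noncomputable abbrev SVec.twist (V : SVec k) : SVec k where
  carrier := FrobTwist k p r V
  gr c := Submodule.span k (FrobTwist.mk k p r '' (V.gr c))
  isCompl := by
    have key : ∀ a b : ZMod 2, ∀ x ∈ Submodule.span k (FrobTwist.mk k p r '' (V.gr a)),
        FrobTwist.map p r (V.proj b) x = if b = a then x else 0 := by
      intro a b x hx
      induction hx using Submodule.span_induction with
      | mem x hx =>
        obtain ⟨v, hv, rfl⟩ := hx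
        rw [FrobTwist.map_mk, V.proj_of_mem hv]
        split_ifs
        · rfl
        · exact map_zero (FrobTwist.mkHom k p r)
      | zero => simp
      | add x y _ _ hx hy => rw [map_add, hx, hy]; split_ifs <;> simp
      | smul c x _ hx => rw [map_smul, hx]; split_ifs <;> simp
    constructor
    · rw [Submodule.disjoint_def]
      intro x h0 h1
      have e0 := key 0 0 x h0
      have e1 := key 1 0 x h1
      rw [if_pos rfl] at e0
      rw [if_neg (by decide)] at e1
      rw [← e0, e1]
    · rw [codisjoint_iff, eq_top_iff]
      intro x _
      induction x using FrobTwist.induction with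
      | h0 => exact zero_mem _
      | h1 c v =>
        refine Submodule.smul_mem _ _ ?_
        have : V.proj 0 v + V.proj 1 v = v := (Fin.sum_univ_two _).symm.trans (V.sum_proj v)
        rw [← this, FrobTwist.mk_add]
        exact Submodule.add_mem_sup (Submodule.subset_span ⟨_, V.proj_mem 0 v, rfl⟩)
          (Submodule.subset_span ⟨_, V.proj_mem 1 v, rfl⟩)
      | h2 x y hx hy => exact add_mem (hx trivial) (hy trivial)

theorem SVec.map_twist_even {V W : SVec k} {f : V →ₗ[k] W} (hf : f ∈ (V.hom W).gr 0) :
    FrobTwist.map p r f ∈ ((V.twist p r).hom (W.twist p r)).gr 0 := by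
  intro a x hx
  rw [add_zero]
  induction hx using Submodule.span_induction with
  | mem x hx =>
    obtain ⟨v, hv, rfl⟩ := hx
    rw [FrobTwist.map_mk]
    exact Submodule.subset_span ⟨_, by simpa using hf a v hv, rfl⟩
  | zero => simp
  | add x y _ _ hx hy => rw [map_add]; exact add_mem hx hy
  | smul c x _ hx => rw [map_smul]; exact Submodule.smul_mem _ _ hx

end Frobenius

section Forms

variable {k : Type u} [Field k] {n : ℕ}

/-- The linear form `v₁ ⊗ ⋯ ⊗ vₙ ↦ ℓ₁(v₁) ⋯ ℓₙ(vₙ)` on a tensor power. -/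
noncomputable def prodForm {V : SVec k} (l : Fin n → V →ₗ[k] k) : TPow k n V →ₗ[k] k :=
  PiTensorProduct.lift ((MultilinearMap.mkPiAlgebra k (Fin n) k).compLinearMap l)

@[simp] theorem prodForm_tprod {V : SVec k} (l : Fin n → V →ₗ[k] k) (v : Fin n → V) :
    prodForm l (PiTensorProduct.tprod k v) = ∏ i, l i (v i) := by
  simp [prodForm]

theorem prodForm_sum {V : SVec k} {X : Type*} [Fintype X] (M : X → V →ₗ[k] k) (t : TPow k n V) :
    prodForm (fun _ => ∑ x, M x) t = ∑ β : Fin n → X, prodForm (fun i => M (β i)) t := by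
  classical
  have : prodForm (n := n) (fun _ => ∑ x, M x)
      = ∑ β : Fin n → X, prodForm (fun i => M (β i)) := by
    refine PiTensorProduct.ext (MultilinearMap.ext fun v => ?_)
    simp only [LinearMap.compMultilinearMap_apply, prodForm_tprod, LinearMap.sum_apply]
    rw [Finset.prod_univ_sum, Fintype.piFinset_univ]
  rw [this, LinearMap.sum_apply]

theorem prodForm_swap {V : SVec k} (M : Fin n → V →ₗ[k] k) (a : Fin n → ZMod 2)
    (hM : ∀ i c v, v ∈ V.gr c → c ≠ a i → M i v = 0) {i j : Fin n} (h : (i : ℕ) + 1 = j)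
    (t : Gamma n V) :
    prodForm (fun l => M (Equiv.swap i j l)) (t : TPow k n V)
      = sgn k (a i * a j) * prodForm M (t : TPow k n V) := by
  have : prodForm (fun l => M (Equiv.swap i j l)) ∘ₗ signedSwap V i j
      = sgn k (a i * a j) • prodForm M := by
    refine TPow.hom_ext fun d v hv => ?_
    rw [LinearMap.comp_apply, signedSwap_tprod V i j d hv, map_smul, LinearMap.smul_apply,
      prodForm_tprod, prodForm_tprod, Equiv.prod_comp (Equiv.swap i j) fun l => M l (v l)]
    by_cases hd : d = a
    · rw [hd]
    · obtain ⟨l, hl⟩ := Function.ne_iff.mp hd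
      rw [Finset.prod_eq_zero (Finset.mem_univ l) (hM l _ _ (hv l) hl)]
      simp
  have := LinearMap.congr_fun this t.1
  rwa [LinearMap.comp_apply, t.2 i j h] at this

open Fin.NatCast in
/-- In characteristic `p`, a function of `p^r` indices that is invariant under adjacent
exchanges has the same sum over all tuples as over the constant ones. -/
theorem sum_eq_sum_const {p r : ℕ} [Fact p.Prime] [CharP k p] {X : Type*} [Fintype X]
    (h : (Fin (p ^ r) → X) → k)
    (hh : ∀ (i j : Fin (p ^ r)), (i : ℕ) + 1 = j → ∀ β, h (fun l => β (Equiv.swap i j l)) = h β) :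
    ∑ β, h β = ∑ x, h fun _ => x := by
  classical
  obtain ⟨m, hm⟩ : ∃ m, p ^ r = m + 1 :=
    Nat.exists_eq_succ_of_ne_zero (pow_ne_zero _ (Fact.out : p.Prime).ne_zero)
  have hm' : p ^ r = m + 1 := hm
  generalize p ^ r = N at h hh hm
  subst hm
  have hperm : ∀ (σ : Equiv.Perm (Fin (m + 1))) (β : Fin (m + 1) → X),
      h (fun l => β (σ l)) = h β := by
    intro σ
    have hσ : σ ∈ Submonoid.closure
        (Set.range fun i : Fin m => Equiv.swap i.castSucc i.succ) := by
      rw [Equiv.Perm.mclosure_swap_castSucc_succ]; trivial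
    induction hσ using Submonoid.closure_induction with
    | mem τ hτ =>
      obtain ⟨i, rfl⟩ := hτ
      exact hh _ _ (by simp)
    | one => intro β; rfl
    | mul τ τ' _ _ h1 h2 =>
      intro β
      exact (h2 fun l => β (τ l)).trans (h1 β)
  let ρ : (Fin (m + 1) → X) → Fin (m + 1) → X := fun β i => β (i + 1)
  have hρ : ∀ β, h (ρ β) = h β := fun β => hperm (Equiv.addRight 1) β
  have hρi : ∀ (s : ℕ) (β : Fin (m + 1) → X) (i : Fin (m + 1)),
      (ρ^[s]) β i = β (i + (s : Fin (m + 1))) := by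
    intro s
    induction s with
    | zero => intro β i; simp
    | succ s ih =>
      intro β i
      rw [Function.iterate_succ_apply, ih]
      change β (i + (s : Fin (m + 1)) + 1) = _
      rw [Nat.cast_succ, add_assoc]
  have hfix : ∀ β, ρ β = β → β = fun _ => β 0 := by
    intro β hβ
    funext i
    have h1 : (ρ^[(i : ℕ)]) β = β := Function.iterate_fixed hβ _
    have h2 := hρi i β 0
    rw [h1, zero_add, Fin.cast_val_eq_self] at h2
    exact h2.symm
  rw [← Finset.sum_fiberwise_of_maps_to (s := Finset.univ) (t := Finset.univ.image h) (g := h)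
      (fun β _ => Finset.mem_image_of_mem h (Finset.mem_univ β)),
    ← Finset.sum_fiberwise_of_maps_to (s := Finset.univ) (t := Finset.univ.image h)
      (g := fun x => h fun _ => x)
      (fun x _ => Finset.mem_image_of_mem h (Finset.mem_univ fun _ => x))]
  refine Finset.sum_congr rfl fun c _ => ?_
  have e1 : ∑ β with h β = c, h β = (Fintype.card {β // h β = c} : k) * c := by
    rw [Finset.sum_congr rfl (g := fun _ => c) (by simp), Finset.sum_const, nsmul_eq_mul,
      Fintype.card_subtype]
  have e2 : ∑ x with h (fun _ => x) = c, h (fun _ => x)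
      = (Fintype.card {x // h (fun _ : Fin (m + 1) => x) = c} : k) * c := by
    rw [Finset.sum_congr rfl (g := fun _ => c) (by simp), Finset.sum_const, nsmul_eq_mul,
      Fintype.card_subtype]
  rw [e1, e2]
  congr 1
  let f : Function.End {β // h β = c} := fun β => ⟨ρ β.1, (hρ _).trans β.2⟩
  have hf : ∀ s : ℕ, ∀ β, ((f ^ s) β).1 = (ρ^[s]) β.1 := by
    intro s
    induction s with
    | zero => intro β; rfl
    | succ s ih =>
      intro β
      rw [pow_succ, Function.iterate_succ_apply, ← show (f β).1 = ρ β.1 from rfl, ← ih]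
      rfl
  have hfp : f ^ p ^ r = 1 := by
    funext β
    refine Subtype.ext ?_
    rw [hf]
    funext i
    rw [hρi, hm', Fin.natCast_self, add_zero]
    rfl
  have hcard := Equiv.Perm.card_fixedPoints_modEq hfp
  have e : Function.fixedPoints f ≃ {x // h (fun _ : Fin (m + 1) => x) = c} :=
    { toFun := fun β => ⟨β.1.1 0, by
        have := hfix β.1.1 (congrArg Subtype.val β.2)
        rw [← this]; exact β.1.2⟩
      invFun := fun x => ⟨⟨fun _ => x.1, x.2⟩, rfl⟩
      left_inv := fun β => Subtype.ext <| Subtype.ext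
        (hfix β.1.1 (congrArg Subtype.val β.2)).symm
      right_inv := fun x => rfl }
  rw [← Fintype.card_congr e]
  exact (CharP.natCast_eq_natCast k p).mpr hcard

end Forms

section FrobeniusFunctor

variable {k : Type u} [Field k] {n : ℕ}

theorem prodForm_smul {V : SVec k} (c : k) (l : V →ₗ[k] k) (t : TPow k n V) :
    prodForm (fun _ => c • l) t = c ^ n * prodForm (fun _ => l) t := by
  have : prodForm (n := n) (fun _ => c • l) = c ^ n • prodForm fun _ => l := by
    refine PiTensorProduct.ext (MultilinearMap.ext fun v => ?_)
    simp [Finset.prod_mul_distrib]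
  rw [this]; rfl

variable (p r : ℕ) [Fact p.Prime] [CharP k p]

theorem prodForm_sum_even {V : SVec k} {X : Type*} [Fintype X] (M : X → V →ₗ[k] k)
    (hM : ∀ x, ∀ v ∈ V.gr 1, M x v = 0) (t : Gamma (p ^ r) V) :
    prodForm (fun _ => ∑ x, M x) (t : TPow k (p ^ r) V)
      = ∑ x, prodForm (fun _ => M x) (t : TPow k (p ^ r) V) := by
  rw [prodForm_sum]
  refine sum_eq_sum_const (p := p)
    (fun β => prodForm (fun i => M (β i)) (t : TPow k (p ^ r) V)) fun i j h β => ?_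
  have := prodForm_swap (fun l => M (β l)) (fun _ => 0) (fun l c v hv hc => by
    rcases zmod2_cases c with rfl | rfl
    · exact absurd rfl hc
    · exact hM _ v hv) h t
  simpa using this

/-- The linear map `i^# : Γ^{p^r}(E) → E^{(r)}`, written in a basis `(eᵢ)` of `E`. By `form_iSharp`
it does not depend on the basis, and it is dual to the inclusion `ℓ^{(r)} ↦ ℓ^{p^r}` of the twist
of the dual space of `E` into the symmetric power `S^{p^r}`, for which `ℓ^{p^r} = ℓ₀^{p^r}`, where
`ℓ₀` is the even part of the linear form `ℓ`. -/
noncomputable def iSharp (E : SVec k) [FiniteDimensional k E] :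
    Gamma (p ^ r) E →ₗ[k] FrobTwist k p r E :=
  ∑ i, ((prodForm fun _ => (Module.finBasis k E).coord i ∘ₗ E.proj 0) ∘ₗ
    (Gamma (p ^ r) E).subtype).smulRight (FrobTwist.mk k p r (Module.finBasis k E i))

theorem iSharp_apply (E : SVec k) [FiniteDimensional k E] (t : Gamma (p ^ r) E) :
    iSharp p r E t = ∑ i, prodForm (fun _ => (Module.finBasis k E).coord i ∘ₗ E.proj 0)
      (t : TPow k (p ^ r) E) • FrobTwist.mk k p r (Module.finBasis k E i) := by
  simp only [iSharp, LinearMap.sum_apply]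
  rfl

theorem form_iSharp (E : SVec k) [FiniteDimensional k E] (l : E →ₗ[k] k) (t : Gamma (p ^ r) E) :
    FrobTwist.form p r l (iSharp p r E t)
      = prodForm (fun _ => l ∘ₗ E.proj 0) (t : TPow k (p ^ r) E) := by
  have hl : l ∘ₗ E.proj 0 = ∑ i, l (Module.finBasis k E i) •
      ((Module.finBasis k E).coord i ∘ₗ E.proj 0) := by
    ext v
    simp only [LinearMap.comp_apply, LinearMap.sum_apply, LinearMap.smul_apply, smul_eq_mul,
      Module.Basis.coord_apply]
    conv_lhs => rw [← (Module.finBasis k E).sum_repr (E.proj 0 v), map_sum]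
    refine Finset.sum_congr rfl fun i _ => ?_
    rw [map_smul, smul_eq_mul, mul_comm]
  rw [hl, prodForm_sum_even, iSharp_apply, map_sum]
  · refine Finset.sum_congr rfl fun i _ => ?_
    rw [map_smul, FrobTwist.form_mk, prodForm_smul, smul_eq_mul, mul_comm]
  · intro i v hv
    rw [LinearMap.smul_apply, LinearMap.comp_apply, E.proj_of_mem hv, if_neg (by decide)]
    simp

theorem iSharp_pow (E : SVec k) [FiniteDimensional k E] (f : E) (hf : f ∈ E.gr 0) :
    iSharp p r E (Gamma.pow f hf) = FrobTwist.mk k p r f := by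
  refine FrobTwist.ext_form fun l => ?_
  rw [form_iSharp, FrobTwist.form_mk]
  simp [Gamma.pow, E.proj_of_mem hf]

theorem map_proj_iSharp (E : SVec k) [FiniteDimensional k E] (t : Gamma (p ^ r) E) :
    FrobTwist.map p r (E.proj 0) (iSharp p r E t) = iSharp p r E t := by
  refine FrobTwist.ext_form fun l => ?_
  have : FrobTwist.form p r l ∘ₗ FrobTwist.map p r (E.proj 0)
      = FrobTwist.form p r (l ∘ₗ E.proj 0) :=
    FrobTwist.hom_ext fun v => by
      rw [LinearMap.comp_apply, FrobTwist.map_mk, FrobTwist.form_mk, FrobTwist.form_mk]; rfl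
  rw [← LinearMap.comp_apply, this, form_iSharp, form_iSharp]
  congr 2; funext i
  ext v
  simp [SVec.proj_proj]

/-- The action of `𝐈^{(r)}` on morphisms. -/
noncomputable def twistMor {V W : SVec k} [FiniteDimensional k V] [FiniteDimensional k W] :
    Gamma (p ^ r) (V.hom W) →ₗ[k] (V.twist p r).hom (W.twist p r) :=
  FrobTwist.homMap p r ∘ₗ iSharp p r (V.hom W)

theorem twistMor_even {V W : SVec k} [FiniteDimensional k V] [FiniteDimensional k W]
    (t : Gamma (p ^ r) (V.hom W)) : twistMor p r t ∈ ((V.twist p r).hom (W.twist p r)).gr 0 := by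
  have : ∀ x : FrobTwist k p r (V.hom W),
      FrobTwist.homMap p r (FrobTwist.map p r ((V.hom W).proj 0) x)
        ∈ ((V.twist p r).hom (W.twist p r)).gr 0 := by
    intro x
    induction x using FrobTwist.induction with
    | h0 => rw [map_zero, map_zero]; exact zero_mem _
    | h1 c f =>
      rw [map_smul, map_smul, FrobTwist.map_mk, FrobTwist.homMap_mk]
      exact Submodule.smul_mem _ _ (SVec.map_twist_even p r ((V.hom W).proj_mem 0 f))
    | h2 x y hx hy => rw [map_add, map_add]; exact add_mem hx hy
  have h := this (iSharp p r (V.hom W) t)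
  rwa [map_proj_iSharp] at h

theorem iSharp_odd (E : SVec k) [FiniteDimensional k E] (t : Gamma (p ^ r) E)
    (ht : (t : TPow k (p ^ r) E) ∈ tensorGr (p ^ r) E 1) : iSharp p r E t = 0 := by
  have key : ∀ l : E →ₗ[k] k, tensorGr (p ^ r) E 1
      ≤ LinearMap.ker (prodForm (n := p ^ r) fun _ => l ∘ₗ E.proj 0) := by
    intro l
    refine Submodule.span_le.mpr ?_
    rintro _ ⟨a, v, hv, ha, rfl⟩
    obtain ⟨i, hi⟩ : ∃ i, a i ≠ 0 := by
      by_contra! h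
      simp [h] at ha
    rw [SetLike.mem_coe, LinearMap.mem_ker, prodForm_tprod]
    refine Finset.prod_eq_zero (Finset.mem_univ i) ?_
    rw [LinearMap.comp_apply, E.proj_of_mem (hv i), if_neg hi.symm, map_zero]
  refine FrobTwist.ext_form fun l => ?_
  rw [form_iSharp, map_zero]
  exact key l ht

/-- The linear form `f ↦ λ(f(u))` on `Hom(U, W)`. -/
noncomputable def evalForm {U W : SVec k} (l : W →ₗ[k] k) (u : U) : U.hom W →ₗ[k] k :=
  l ∘ₗ LinearMap.applyₗ u

theorem evalForm_apply {U W : SVec k} (l : W →ₗ[k] k) (u : U) (f : U →ₗ[k] W) :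
    evalForm l u f = l (f u) := rfl

theorem form_twistMor {V W : SVec k} [FiniteDimensional k V] [FiniteDimensional k W]
    (t : Gamma (p ^ r) (V.hom W)) (l : W →ₗ[k] k) (v : V) :
    FrobTwist.form p r l (twistMor p r t (FrobTwist.mk k p r v))
      = prodForm (fun _ => evalForm l v ∘ₗ (V.hom W).proj 0)
        (t : TPow k (p ^ r) (V.hom W)) := by
  rw [← form_iSharp]
  change FrobTwist.form p r l (FrobTwist.homMap p r (iSharp p r (V.hom W) t) _) = _
  generalize iSharp p r (V.hom W) t = x
  induction x using FrobTwist.induction with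
  | h0 => simp
  | h1 c f =>
    rw [map_smul, map_smul, LinearMap.smul_apply, map_smul, FrobTwist.homMap_mk,
      FrobTwist.map_mk, FrobTwist.form_mk, FrobTwist.form_mk, evalForm_apply]
  | h2 x y hx hy => rw [map_add, map_add, LinearMap.add_apply, map_add, hx, hy]

/-- The value of a power of a linear form on a composite, expanded in a basis of the middle space
and in parities. -/
theorem prodForm_compT {U V W : SVec k} {X : Type*} [Fintype X] (b : Module.Basis X k V)
    (l : W →ₗ[k] k) (u : U) (y : TPow k n (V.hom W)) (x : TPow k n (U.hom V)) :
    prodForm (fun _ => evalForm l u ∘ₗ (U.hom W).proj 0) (compT U V W y x)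
      = ∑ β : Fin n → X × ZMod 2,
        sgn k (koszul (fun i => (β i).2) fun i => (β i).2) *
        (prodForm (fun i => evalForm l (b (β i).1) ∘ₗ (V.hom W).proj (β i).2) y *
          prodForm (fun i => evalForm (b.coord (β i).1) u ∘ₗ (U.hom V).proj (β i).2) x) := by
  classical
  have key : (compT U V W).compr₂ (prodForm (n := n) fun _ => evalForm l u ∘ₗ (U.hom W).proj 0)
      = ∑ β : Fin n → X × ZMod 2,
        sgn k (koszul (fun i => (β i).2) fun i => (β i).2) •
        (LinearMap.mul k k).compl₁₂
          (prodForm fun i => evalForm l (b (β i).1) ∘ₗ (V.hom W).proj (β i).2)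
          (prodForm fun i => evalForm (b.coord (β i).1) u ∘ₗ (U.hom V).proj (β i).2) := by
    refine TPow.hom_ext fun c g hg => TPow.hom_ext fun d f hf => ?_
    simp only [LinearMap.sum_apply, LinearMap.smul_apply, LinearMap.compr₂_apply,
      LinearMap.compl₁₂_apply, LinearMap.mul_apply', prodForm_tprod, compT_tprod c d hg hf,
      map_smul, smul_eq_mul, ← Finset.prod_mul_distrib]
    have h1 : ∀ β : Fin n → X × ZMod 2,
        sgn k (koszul (fun i => (β i).2) fun i => (β i).2) *
          ∏ i, (evalForm l (b (β i).1) ∘ₗ (V.hom W).proj (β i).2) (g i) *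
            (evalForm (b.coord (β i).1) u ∘ₗ (U.hom V).proj (β i).2) (f i)
        = sgn k (koszul c d) *
          ∏ i, (evalForm l (b (β i).1) ∘ₗ (V.hom W).proj (β i).2) (g i) *
            (evalForm (b.coord (β i).1) u ∘ₗ (U.hom V).proj (β i).2) (f i) := by
      intro β
      by_cases h : (fun i => (β i).2) = c ∧ (fun i => (β i).2) = d
      · rw [h.1, ← h.2, h.1]
      · have : ∃ i, (β i).2 ≠ c i ∨ (β i).2 ≠ d i := by
          by_contra! hc
          exact h ⟨funext fun i => (hc i).1, funext fun i => (hc i).2⟩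
        obtain ⟨i, hi⟩ := this
        rw [Finset.prod_eq_zero (Finset.mem_univ i), mul_zero, mul_zero]
        rw [LinearMap.comp_apply, LinearMap.comp_apply, SVec.proj_of_mem _ (hg i),
          SVec.proj_of_mem _ (hf i)]
        rcases hi with hi | hi <;> simp [hi]
    rw [Finset.sum_congr rfl fun β _ => h1 β, ← Finset.mul_sum]
    congr 1
    have h2 := Finset.prod_univ_sum (fun _ : Fin n => (Finset.univ : Finset (X × ZMod 2)))
      (fun i x => (evalForm l (b x.1) ∘ₗ (V.hom W).proj x.2) (g i) *
            (evalForm (b.coord x.1) u ∘ₗ (U.hom V).proj x.2) (f i))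
    rw [Fintype.piFinset_univ] at h2
    rw [← h2]
    refine Finset.prod_congr rfl fun i _ => ?_
    rw [LinearMap.comp_apply, SVec.proj_of_mem _ (SVec.comp_mem (hg i) (hf i)),
      Fintype.sum_prod_type_right]
    simp only [LinearMap.comp_apply, SVec.proj_of_mem _ (hg i), SVec.proj_of_mem _ (hf i)]
    by_cases hcd : c i = d i
    · rw [if_pos (by rw [hcd]; exact (by decide : ∀ a : ZMod 2, 0 = a + a) _),
        Finset.sum_eq_single (c i)]
      · rw [if_pos rfl, if_pos hcd, evalForm_apply]
        rw [LinearMap.comp_apply]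
        conv_lhs => rw [← b.sum_repr (f i u), map_sum, map_sum]
        refine Finset.sum_congr rfl fun j _ => ?_
        rw [map_smul, map_smul, smul_eq_mul, mul_comm]; rfl
      · intro a _ ha
        refine Finset.sum_eq_zero fun j _ => ?_
        rw [if_neg ha, map_zero, zero_mul]
      · simp
    · rw [if_neg ((by decide : ∀ a b : ZMod 2, a ≠ b → ¬ 0 = a + b) _ _ hcd), map_zero]
      refine (Finset.sum_eq_zero fun a _ => Finset.sum_eq_zero fun j _ => ?_).symm
      by_cases ha : a = c i
      · rw [if_neg (fun h : a = d i => hcd (ha.symm.trans h)), map_zero, mul_zero]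
      · rw [if_neg ha, map_zero, zero_mul]
  have := LinearMap.congr_fun₂ key y x
  simpa only [LinearMap.sum_apply, LinearMap.smul_apply, LinearMap.compr₂_apply,
      LinearMap.compl₁₂_apply, LinearMap.mul_apply', smul_eq_mul] using this

theorem evalForm_proj_eq_zero {V W : SVec k} (l : W →ₗ[k] k) (v : V) {a c : ZMod 2} {f : V.hom W}
    (hf : f ∈ (V.hom W).gr c) (hc : c ≠ a) :
    (evalForm l v ∘ₗ (V.hom W).proj a) f = 0 := by
  rw [LinearMap.comp_apply, SVec.proj_of_mem _ hf, if_neg hc.symm, map_zero]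

theorem twistMor_comp (hp : 3 ≤ p) (hr : 0 < r) {U V W : SVec k} [FiniteDimensional k U]
    [FiniteDimensional k V] [FiniteDimensional k W] (y : Gamma (p ^ r) (V.hom W))
    (x : Gamma (p ^ r) (U.hom V)) :
    twistMor p r (Gamma.comp y x)
      = (twistMor p r y : V.twist p r →ₗ[k] W.twist p r) ∘ₗ
        (twistMor p r x : U.twist p r →ₗ[k] V.twist p r) := by
  refine FrobTwist.hom_ext fun u => FrobTwist.ext_form fun l => ?_
  let b := Module.finBasis k V
  rw [form_twistMor]
  change prodForm _ (compT U V W y.1 x.1) = _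
  rw [prodForm_compT b l u, sum_eq_sum_const (p := p), Fintype.sum_prod_type_right]
  · have hodd : ∀ j, prodForm (fun _ => evalForm l (b j) ∘ₗ (V.hom W).proj 1) y.1 = 0 := by
      intro j
      have h1 : 1 < p ^ r := Nat.one_lt_pow hr.ne' (by omega)
      have := prodForm_swap (fun _ : Fin (p ^ r) => evalForm l (b j) ∘ₗ (V.hom W).proj 1)
        (fun _ => 1) (fun i c v hv hc => evalForm_proj_eq_zero l _ hv hc)
        (i := ⟨0, by omega⟩) (j := ⟨1, h1⟩) rfl y
      rw [mul_one, sgn_one, neg_one_mul] at this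
      have h2 : (2 : k) ≠ 0 := by
        have := (CharP.cast_eq_zero_iff k p 2).not.mpr fun h =>
          absurd (Nat.le_of_dvd (by norm_num) h) (by omega)
        exact_mod_cast this
      have h3 := eq_neg_iff_add_eq_zero.mp this
      rw [← two_mul] at h3
      exact (mul_eq_zero.mp h3).resolve_left h2
    rw [LinearMap.comp_apply,
      FrobTwist.eq_sum_basis b (twistMor p r x (FrobTwist.mk k p r u)), map_sum, map_sum]
    refine (Fin.sum_univ_two _).trans ?_
    have hz : (∑ j, sgn k (koszul (fun _ : Fin (p ^ r) => 1) fun _ => 1) *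
        (prodForm (fun _ => evalForm l (b j) ∘ₗ (V.hom W).proj 1) y.1 *
          prodForm (fun _ => evalForm (b.coord j) u ∘ₗ (U.hom V).proj 1) x.1)) = 0 :=
      Finset.sum_eq_zero fun j _ => by rw [hodd, zero_mul, mul_zero]
    refine (congrArg₂ (· + ·) rfl hz).trans ?_
    rw [add_zero]
    refine Finset.sum_congr rfl fun j _ => ?_
    rw [map_smul, map_smul, form_twistMor, form_twistMor, smul_eq_mul, mul_comm (prodForm _ x.1)]
    have : koszul (fun _ : Fin (p ^ r) => 0) (fun _ => 0) = 0 := by simp [koszul]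
    change sgn k (koszul (fun _ : Fin (p ^ r) => 0) fun _ => 0) * _ = _
    rw [this, sgn_zero, one_mul]
    rfl
  · intro i j h β
    have hk := koszul_swap (fun l => (β l).2) (fun l => (β l).2) h
    rw [mul_comm, add_left_inj] at hk
    have h1 := prodForm_swap (fun i => evalForm l (b (β i).1) ∘ₗ (V.hom W).proj (β i).2)
      (fun i => (β i).2) (fun i c v hv hc => evalForm_proj_eq_zero l _ hv hc) h y
    have h2 := prodForm_swap (fun i => evalForm (b.coord (β i).1) u ∘ₗ (U.hom V).proj (β i).2)
      (fun i => (β i).2) (fun i c v hv hc => evalForm_proj_eq_zero _ _ hv hc) h x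
    rw [hk, h1, h2, mul_mul_mul_comm (sgn k _), sgn_mul_self, one_mul]

/-- The Frobenius twist superfunctor `𝐈^{(r)}`, of degree `p^r`, for `r > 0`. -/
noncomputable def frobTwist (k : Type u) [Field k] (p r : ℕ) [Fact p.Prime] [CharP k p]
    (hp : 3 ≤ p) (hr : 0 < r) : StrictPolySuperfunctor k (p ^ r) where
  obj V _ := V.twist p r
  map {_ _} _ _ := twistMor p r
  map_id V _ := by
    refine FrobTwist.hom_ext fun v => ?_
    change FrobTwist.homMap p r (iSharp p r (V.hom V) (Gamma.pow _ _)) _ = _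
    rw [iSharp_pow, FrobTwist.homMap_mk, FrobTwist.map_mk]
    rfl
  map_comp y x := twistMor_comp p r hp hr y x
  map_even {V W} _ _ c t ht := by
    rcases zmod2_cases c with rfl | rfl
    · exact twistMor_even p r t
    · have : twistMor p r t = 0 := by
        change FrobTwist.homMap p r (iSharp p r (V.hom W) t) = 0
        rw [iSharp_odd p r _ t ht, map_zero]
      rw [this]
      exact zero_mem _

/-- The subfunctor `𝐈_c^{(r)}` of `𝐈^{(r)}`, with `𝐈_c^{(r)}(V) = V_c^{(r)}` placed in parity
`c`. -/
noncomputable def frobPart (k : Type u) [Field k] (p r : ℕ) [Fact p.Prime] [CharP k p]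
    (hp : 3 ≤ p) (hr : 0 < r) (c : ZMod 2) : StrictPolySuperfunctor k (p ^ r) :=
  (frobTwist k p r hp hr).parityPart (fun _ _ _ _ t => twistMor_even p r t) c

end FrobeniusFunctor

end StrictPoly

open StrictPoly

/-!
An additive superfunctor `A` is controlled by its values on the two lines `k_c`, that is, on `k`
placed in parity `c = 0, 1`.

**The degree.** Let `V` be a space with `A(V) ≠ 0`, let `π₁, π₂ : V ⊕ V → V` be the projections,
and let `z ∈ Γᵈ Hom(V ⊕ V, V)` be the sum of all tensors with `m` factors `π₁` and `d - m` factors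
`π₂`. If `0 < m < d`, the composites of `z` with both inclusions `V → V ⊕ V` vanish, so `A(z) = 0`
by additivity. The composite of `z` with the diagonal of `V` is the identity of `V` multiplied by
the binomial coefficient `C(d, m)`, which is therefore divisible by `p`
(`IsAdditive.cast_choose_eq_zero`). As `d ≠ 0` (`IsAdditive.degree_ne_zero`), this forces `d` to be
a power of `p`.

**Degree `p^r` with `r > 0`.** Additivity makes `f ↦ A(f ⊗ ⋯ ⊗ f)` additive on even maps `f`
(`IsAdditive.isEvenAdditive`). Hence, for `m ∈ A(k_c)`, sending `v ∈ V_c` to `A(j ⊗ ⋯ ⊗ j)(m)`,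
where `j : k_c → V` takes `1` to `v`, is additive and `p^r`-semilinear in `v`, so it extends to a
linear map `V_c^{(r)} → A(V)` (`evalTwist`). It is natural in `V` (`map_evalTwist`): a morphism from
`k_c` can be cut into pieces by the rank one idempotents of a homogeneous basis of the target, and
each piece is a multiple of some `j ⊗ ⋯ ⊗ j`, because `Γⁿ` of an even line is spanned by a power and
`Γⁿ` of an odd line is zero for `n ≥ 2`, as `2 ≠ 0`
(`Gamma.exists_rankOne_comp_eq`, `exists_map_eq_sum`). With `m` running through homogeneous bases of
`A(k_0)` and `A(k_1)`, these maps add up to the isomorphism. The identity of `V` is the sum of its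
rank one idempotents, which gives surjectivity; the linear forms `A(V) → A(k_c) → k` made of
coordinates on `V` and on `A(k_c)` give injectivity.

**Degree `1`.** The same construction applies with `Γ¹ Hom(V, W) = Hom(V, W)`. Now odd maps act as
well, so `V` is not split into its two parts, and the line `k_0` suffices.
-/

/-! ### Even maps and additivity -/

namespace StrictPoly

section Even

variable {k : Type u} [Field k] {n : ℕ}

theorem SVec.add_mem_even {V W : SVec k} {f g : V →ₗ[k] W} (hf : f ∈ (V.hom W).gr 0)
    (hg : g ∈ (V.hom W).gr 0) : f + g ∈ (V.hom W).gr 0 :=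
  add_mem hf hg

theorem SVec.comp_mem_even {U V W : SVec k} {g : V →ₗ[k] W} {f : U →ₗ[k] V}
    (hg : g ∈ (V.hom W).gr 0) (hf : f ∈ (U.hom V).gr 0) : g ∘ₗ f ∈ (U.hom W).gr 0 := by
  simpa using SVec.comp_mem hg hf

theorem SVec.fst_even (V W : SVec k) : LinearMap.fst k V W ∈ ((V.prod W).hom V).gr 0 := by
  intro a v hv
  simpa using hv.1

theorem SVec.snd_even (V W : SVec k) : LinearMap.snd k V W ∈ ((V.prod W).hom W).gr 0 := by
  intro a v hv
  simpa using hv.2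

theorem SVec.diag_even (V : SVec k) :
    LinearMap.prod (LinearMap.id : V →ₗ[k] V) LinearMap.id ∈ (V.hom (V.prod V)).gr 0 := by
  intro a v hv
  have hv' : v ∈ V.gr (a + 0) := by rwa [add_zero]
  exact ⟨hv', hv'⟩

/-- The `n`-th tensor power `f ⊗ ⋯ ⊗ f` of an even linear map `f : V → W`, as a morphism. -/
noncomputable def Gamma.powHom (n : ℕ) {V W : SVec k} (f : V →ₗ[k] W)
    (hf : f ∈ (V.hom W).gr 0) : Gamma n (V.hom W) :=
  Gamma.pow (V := V.hom W) f hf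

theorem Gamma.coe_powHom {V W : SVec k} (f : V →ₗ[k] W) (hf : f ∈ (V.hom W).gr 0) :
    (Gamma.powHom n f hf : TPow k n (V.hom W)) = PiTensorProduct.tprod k fun _ => f := rfl

theorem Gamma.coe_comp {U V W : SVec k} (y : Gamma n (V.hom W)) (x : Gamma n (U.hom V)) :
    (Gamma.comp y x : TPow k n (U.hom W)) = compT U V W y x := rfl

theorem compT_tprod_even {U V W : SVec k} {g : Fin n → V →ₗ[k] W} {f : Fin n → U →ₗ[k] V}
    (hg : ∀ i, g i ∈ (V.hom W).gr 0) (hf : ∀ i, f i ∈ (U.hom V).gr 0) :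
    compT U V W (PiTensorProduct.tprod k g) (PiTensorProduct.tprod k f)
      = PiTensorProduct.tprod k fun i => ((g i ∘ₗ f i : U →ₗ[k] W) : U.hom W) := by
  rw [compT_tprod (fun _ => 0) (fun _ => 0) hg hf]
  simp [koszul]

theorem Gamma.comp_powHom {U V W : SVec k} {g : V →ₗ[k] W} {f : U →ₗ[k] V}
    (hg : g ∈ (V.hom W).gr 0) (hf : f ∈ (U.hom V).gr 0) :
    Gamma.comp (Gamma.powHom n g hg) (Gamma.powHom n f hf)
      = Gamma.powHom n (g ∘ₗ f) (SVec.comp_mem_even hg hf) :=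
  Subtype.ext (compT_tprod_even (fun _ => hg) (fun _ => hf))

theorem Gamma.comp_smul {U V W : SVec k} (y : Gamma n (V.hom W)) (c : k)
    (x : Gamma n (U.hom V)) : Gamma.comp y (c • x) = c • Gamma.comp y x :=
  Subtype.ext (map_smul (compT U V W y.1) c x.1)

theorem Gamma.powHom_smul {V W : SVec k} (c : k) {f : V →ₗ[k] W} (hf : f ∈ (V.hom W).gr 0) :
    Gamma.powHom n (c • f) (Submodule.smul_mem _ c hf) = c ^ n • Gamma.powHom n f hf := by
  refine Subtype.ext ?_
  have := (PiTensorProduct.tprod k (s := fun _ : Fin n => V.hom W)).map_smul_univ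
    (fun _ => c) (fun _ => f)
  rw [Finset.prod_const, Finset.card_univ, Fintype.card_fin] at this
  exact this

theorem Gamma.powHom_zero (hn : n ≠ 0) {V W : SVec k} :
    Gamma.powHom n (0 : V →ₗ[k] W) (zero_mem _) = 0 :=
  Subtype.ext (MultilinearMap.map_coord_zero _ (⟨0, Nat.pos_of_ne_zero hn⟩ : Fin n) rfl)

end Even

namespace StrictPolySuperfunctor

variable {k : Type u} [Field k] {n : ℕ} (A : StrictPolySuperfunctor k n)

/-- The value of a superfunctor on the tensor power of an even linear map. -/
noncomputable def onEven {V W : SVec k} [FiniteDimensional k V] [FiniteDimensional k W]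
    (f : V →ₗ[k] W) (hf : f ∈ (V.hom W).gr 0) : A.obj V →ₗ[k] A.obj W :=
  A.map (Gamma.powHom n f hf)

variable {A} {U V W : SVec k} [FiniteDimensional k U] [FiniteDimensional k V]
  [FiniteDimensional k W]

theorem onEven_congr {f g : V →ₗ[k] W} (h : f = g) (hf : f ∈ (V.hom W).gr 0) :
    A.onEven f hf = A.onEven g (h ▸ hf) := by
  subst h; rfl

theorem onEven_id (hV : (LinearMap.id : V →ₗ[k] V) ∈ (V.hom V).gr 0) :
    A.onEven LinearMap.id hV = LinearMap.id :=
  A.map_id V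

theorem map_comp_apply (y : Gamma n (V.hom W)) (x : Gamma n (U.hom V)) (a : A.obj U) :
    A.map (Gamma.comp y x) a = A.map y (A.map x a) := by
  rw [A.map_comp]; rfl

theorem onEven_onEven {g : V →ₗ[k] W} {f : U →ₗ[k] V} {e : U →ₗ[k] W} (h : g ∘ₗ f = e)
    (he : e ∈ (U.hom W).gr 0) {hg : g ∈ (V.hom W).gr 0} {hf : f ∈ (U.hom V).gr 0}
    (a : A.obj U) : A.onEven g hg (A.onEven f hf a) = A.onEven e he a := by
  subst h
  rw [onEven, onEven, ← map_comp_apply, Gamma.comp_powHom]; rfl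

theorem onEven_smul (c : k) {f : V →ₗ[k] W} (hf : f ∈ (V.hom W).gr 0) :
    A.onEven (c • f) (Submodule.smul_mem _ c hf) = c ^ n • A.onEven f hf := by
  rw [onEven, Gamma.powHom_smul c hf, map_smul]; rfl

theorem onEven_zero (hn : n ≠ 0) : A.onEven (0 : V →ₗ[k] W) (zero_mem _) = 0 := by
  rw [onEven, Gamma.powHom_zero hn, map_zero]

theorem onEven_mem {f : V →ₗ[k] W} (hf : f ∈ (V.hom W).gr 0) {c : ZMod 2} {a : A.obj V}
    (ha : a ∈ (A.obj V).gr c) : A.onEven f hf a ∈ (A.obj W).gr c := by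
  have h : (Gamma.powHom n f hf : TPow k n (V.hom W)) ∈ tensorGr n (V.hom W) 0 :=
    Submodule.subset_span ⟨fun _ => 0, fun _ => f, fun _ => hf, by simp, rfl⟩
  have := A.map_even 0 _ h c a ha
  rwa [add_zero] at this

/-- For an additive superfunctor, `A(V ⊕ V)` is spanned by the images of the two inclusions. -/
theorem IsAdditive.exists_eq (hA : A.IsAdditive) (x : A.obj (V.prod W)) :
    ∃ a b, x = A.onEven (LinearMap.inl k V W) (inl_even V W) a
      + A.onEven (LinearMap.inr k V W) (inr_even V W) b := by
  obtain ⟨⟨a, b⟩, h⟩ := (hA V W).2 x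
  exact ⟨a, b, h.symm⟩

variable (A) in
/-- `f ↦ A(f ⊗ ⋯ ⊗ f)` is additive on even maps `f`. -/
def IsEvenAdditive : Prop :=
  ∀ (V W : SVec k) [FiniteDimensional k V] [FiniteDimensional k W] (f g : V →ₗ[k] W)
    (hf : f ∈ (V.hom W).gr 0) (hg : g ∈ (V.hom W).gr 0),
    A.onEven (f + g) (SVec.add_mem_even hf hg) = A.onEven f hf + A.onEven g hg

/-- The diagonal of `V` acts as the sum of the two inclusions `V → V ⊕ V`; composing with
`(f, g) : V ⊕ V → W` gives the additivity on even maps. -/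
theorem IsAdditive.isEvenAdditive (hA : A.IsAdditive) (hn : n ≠ 0) : A.IsEvenAdditive := by
  intro V W _ _ f g hf hg
  have hfg : LinearMap.coprod f g ∈ ((V.prod V).hom W).gr 0 := fun a v hv => by
    rw [LinearMap.coprod_apply]
    exact add_mem (hf a _ hv.1) (hg a _ hv.2)
  ext a
  obtain ⟨x, y, hxy⟩ := hA.exists_eq (A.onEven _ V.diag_even a)
  have h1 := congrArg (A.onEven _ (SVec.fst_even V V)) hxy
  have h2 := congrArg (A.onEven _ (SVec.snd_even V V)) hxy
  have h3 := congrArg (A.onEven _ hfg) hxy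
  rw [map_add, onEven_onEven (LinearMap.fst_prod _ _) V.id_mem,
    onEven_onEven (LinearMap.fst_comp_inl _ _ _) V.id_mem,
    onEven_onEven (LinearMap.fst_comp_inr _ _ _) (zero_mem _), onEven_id, onEven_zero hn] at h1
  rw [map_add, onEven_onEven (LinearMap.snd_prod _ _) V.id_mem,
    onEven_onEven (LinearMap.snd_comp_inl _ _ _) (zero_mem _),
    onEven_onEven (LinearMap.snd_comp_inr _ _ _) V.id_mem, onEven_id, onEven_zero hn] at h2
  have hx : a = x := by simpa using h1
  have hy : a = y := by simpa using h2
  rw [map_add, onEven_onEven (e := f + g) (by ext; simp) (SVec.add_mem_even hf hg),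
    onEven_onEven (LinearMap.coprod_inl f g) hf, onEven_onEven (LinearMap.coprod_inr f g) hg,
    ← hx, ← hy] at h3
  exact h3

theorem IsEvenAdditive.onEven_sum (hA : A.IsEvenAdditive) (hn : n ≠ 0) {X : Type*} (s : Finset X)
    {f : X → V →ₗ[k] W} (hf : ∀ x, f x ∈ (V.hom W).gr 0) :
    A.onEven (∑ x ∈ s, f x) (Submodule.sum_mem _ fun x _ => hf x)
      = ∑ x ∈ s, A.onEven (f x) (hf x) := by
  classical
  induction s using Finset.induction_on with
  | empty => exact onEven_zero hn
  | insert x s hx ih =>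
    refine (onEven_congr (Finset.sum_insert hx) _).trans
      ((hA _ _ _ _ (hf x) (Submodule.sum_mem _ fun x _ => hf x)).trans ?_)
    rw [ih, Finset.sum_insert hx]

end StrictPolySuperfunctor

/-! ### The degree -/

section Degree

variable {k : Type u} [Field k] {n : ℕ}

/-- The sum of all tensors with `m` factors `π₁` and `n - m` factors `π₂`, where `π₁` and `π₂` are
the two projections `V ⊕ V → V`. -/
noncomputable def shuffle (n m : ℕ) (V : SVec k) : Gamma n (SVec.hom (V.prod V) V) :=
  ⟨∑ s ∈ (Finset.univ : Finset (Fin n)).powersetCard m,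
      PiTensorProduct.tprod k (s := fun _ : Fin n => SVec.hom (V.prod V) V) fun i =>
        if i ∈ s then LinearMap.fst k V V else LinearMap.snd k V V,
    fun i j _ => by
      rw [map_sum]
      refine Finset.sum_equiv (Equiv.finsetCongr (Equiv.swap i j)) (fun s => by simp)
        fun s _ => ?_
      rw [signedSwap_tprod (SVec.hom (V.prod V) V) i j (fun _ => 0) (fun l => ?_)]
      · simp [Finset.mem_map_equiv]
      · split_ifs
        exacts [SVec.fst_even V V, SVec.snd_even V V]⟩

theorem coe_shuffle (n m : ℕ) (V : SVec k) :
    (shuffle n m V : TPow k n (SVec.hom (V.prod V) V))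
      = ∑ s ∈ (Finset.univ : Finset (Fin n)).powersetCard m,
        PiTensorProduct.tprod k fun i =>
          if i ∈ s then LinearMap.fst k V V else LinearMap.snd k V V := rfl

theorem shuffle_comp_powHom {U V : SVec k} (m : ℕ) {f : U →ₗ[k] V × V}
    (hf : f ∈ (U.hom (V.prod V)).gr 0) :
    (Gamma.comp (shuffle n m V) (Gamma.powHom n f hf) : TPow k n (U.hom V))
      = ∑ s ∈ (Finset.univ : Finset (Fin n)).powersetCard m, PiTensorProduct.tprod k fun i =>
          (if i ∈ s then LinearMap.fst k V V else LinearMap.snd k V V) ∘ₗ f := by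
  rw [Gamma.coe_comp, coe_shuffle, Gamma.coe_powHom, map_sum, LinearMap.sum_apply]
  refine Finset.sum_congr rfl fun s _ => compT_tprod_even (fun i => ?_) fun _ => hf
  split_ifs
  exacts [SVec.fst_even V V, SVec.snd_even V V]

namespace StrictPolySuperfunctor

variable {A : StrictPolySuperfunctor k n}

/-- In degree `0` the two inclusions `V → V ⊕ V` act in the same way, so that additivity makes
every value vanish. -/
theorem IsAdditive.degree_ne_zero (hA : A.IsAdditive) (h : A.IsNonzero) : n ≠ 0 := by
  rintro rfl
  obtain ⟨V, _, _⟩ := h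
  obtain ⟨a, ha⟩ := exists_ne (0 : A.obj V)
  have e : A.mapInl V V = A.mapInr V V :=
    congrArg A.map (Subtype.ext (congrArg (PiTensorProduct.tprod k) (Subsingleton.elim _ _)))
  have := (hA V V).1 (a₁ := (a, -a)) (a₂ := 0) (by simp [e])
  exact ha (congrArg Prod.fst this)

theorem IsAdditive.cast_choose_eq_zero (hA : A.IsAdditive) (h : A.IsNonzero) {m : ℕ} (hm : 0 < m)
    (hmn : m < n) : (n.choose m : k) = 0 := by
  obtain ⟨V, _, _⟩ := h
  have hinl : Gamma.comp (shuffle n m V) (Gamma.powHom n _ (inl_even V V)) = 0 := by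
    refine Subtype.ext ((shuffle_comp_powHom m _).trans (Finset.sum_eq_zero fun s hs => ?_))
    obtain ⟨i, hi⟩ : ∃ i, i ∉ s := by
      by_contra! hc
      rw [Finset.mem_powersetCard_univ, Finset.eq_univ_iff_forall.mpr hc] at hs
      simp at hs; omega
    refine MultilinearMap.map_coord_zero _ i ?_
    rw [if_neg hi]; ext; simp
  have hinr : Gamma.comp (shuffle n m V) (Gamma.powHom n _ (inr_even V V)) = 0 := by
    refine Subtype.ext ((shuffle_comp_powHom m _).trans (Finset.sum_eq_zero fun s hs => ?_))
    obtain ⟨i, hi⟩ : s.Nonempty := by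
      rw [← Finset.card_pos, Finset.mem_powersetCard_univ.mp hs]; exact hm
    refine MultilinearMap.map_coord_zero _ i ?_
    rw [if_pos hi]; ext; simp
  have hz : ∀ x, A.map (shuffle n m V) x = 0 := by
    intro x
    obtain ⟨a, b, rfl⟩ := hA.exists_eq x
    rw [map_add, onEven, onEven, ← map_comp_apply, ← map_comp_apply, hinl, hinr]
    simp
  have hdiag : Gamma.comp (shuffle n m V) (Gamma.powHom n _ V.diag_even)
      = (n.choose m : k) • Gamma.id n V := by
    refine Subtype.ext ((shuffle_comp_powHom m _).trans ?_)
    rw [Finset.sum_congr rfl (g := fun _ => (Gamma.id n V).1) fun s _ => ?_]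
    · simp [Finset.card_powersetCard, ← Nat.cast_smul_eq_nsmul k]
    · refine congrArg (PiTensorProduct.tprod k) (funext fun i => ?_)
      split_ifs <;> rfl
  obtain ⟨a, ha⟩ := exists_ne (0 : A.obj V)
  have h1 := A.map_comp_apply (shuffle n m V) (Gamma.powHom n _ V.diag_even) a
  rw [hz, hdiag, map_smul, A.map_id] at h1
  exact (smul_eq_zero.mp h1).resolve_right ha

end StrictPolySuperfunctor

/-- The degree of a nonzero additive superfunctor is a power of the characteristic. -/
theorem StrictPolySuperfunctor.IsAdditive.exists_degree_eq (p : ℕ) [Fact p.Prime] [CharP k p]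
    {A : StrictPolySuperfunctor k n} (hA : A.IsAdditive) (h : A.IsNonzero) :
    ∃ r : ℕ, n = p ^ r := by
  refine ⟨_, Choose.eq_pow_multiplicity_of_choose_modEq_zero_nat
    (Nat.pos_of_ne_zero (hA.degree_ne_zero h)) fun m hm => ?_⟩
  rw [Nat.modEq_zero_iff_dvd, ← CharP.cast_eq_zero_iff k p]
  obtain ⟨h1, h2⟩ := Finset.mem_Icc.mp hm
  exact hA.cast_choose_eq_zero h (by omega) (by omega)

end Degree

end StrictPoly

/-! ### Lines, homogeneous bases and direct sums -/

namespace StrictPoly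

variable {k : Type u} [Field k] {n : ℕ}

/-- The line `k`, placed in parity `c`. -/
abbrev SVec.line (k : Type u) [Field k] (c : ZMod 2) : SVec k where
  carrier := k
  gr b := if b = c then ⊤ else ⊥
  isCompl := by
    rcases zmod2_cases c with rfl | rfl
    · simpa using isCompl_top_bot
    · simpa using isCompl_bot_top

theorem SVec.mem_line (c : ZMod 2) (x : k) : x ∈ (SVec.line k c).gr c := by
  simp

theorem SVec.eq_zero_of_mem_line {a c : ZMod 2} (h : a ≠ c) {x : k}
    (hx : x ∈ (SVec.line k c).gr a) : x = 0 := by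
  simpa [h] using hx

theorem SVec.toSpanSingleton_mem {V : SVec k} {a : ZMod 2} (c : ZMod 2) {v : V}
    (hv : v ∈ V.gr (c + a)) : LinearMap.toSpanSingleton k V v ∈ ((SVec.line k c).hom V).gr a := by
  intro b x hx
  by_cases h : b = c
  · subst h
    exact Submodule.smul_mem _ _ hv
  · rw [SVec.eq_zero_of_mem_line h hx, map_zero]
    exact zero_mem _

theorem SVec.toSpanSingleton_even {V : SVec k} {c : ZMod 2} {v : V} (hv : v ∈ V.gr c) :
    LinearMap.toSpanSingleton k V v ∈ ((SVec.line k c).hom V).gr 0 :=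
  SVec.toSpanSingleton_mem c (by rwa [add_zero])

theorem SVec.form_even {V : SVec k} {c : ZMod 2} {l : V →ₗ[k] k}
    (hl : ∀ a ≠ c, ∀ v ∈ V.gr a, l v = 0) : l ∈ (V.hom (SVec.line k c)).gr 0 := by
  intro a v hv
  rw [add_zero]
  by_cases h : a = c
  · subst h
    exact SVec.mem_line _ _
  · rw [hl a h v hv]
    exact zero_mem _

/-- Every super vector space has a basis of homogeneous vectors. -/
theorem SVec.exists_homogeneous_basis (V : SVec k) :
    ∃ (X : Type u) (b : Module.Basis X k V) (q : X → ZMod 2), ∀ x, b x ∈ V.gr (q x) := by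
  refine ⟨_, ((Module.Basis.ofVectorSpace k (V.gr 0)).prod
    (Module.Basis.ofVectorSpace k (V.gr 1))).map (Submodule.prodEquivOfIsCompl _ _ V.isCompl),
    Sum.elim (fun _ => 0) (fun _ => 1), ?_⟩
  rintro (x | x) <;> simp

theorem SVec.coord_eq_zero {V : SVec k} {X : Type*} {b : Module.Basis X k V} {q : X → ZMod 2}
    (hb : ∀ x, b x ∈ V.gr (q x)) (x : X) (a : ZMod 2) (ha : a ≠ q x) (v : V) (hv : v ∈ V.gr a) :
    b.coord x v = 0 := by
  have h : b.coord x ∘ₗ V.proj (q x) = b.coord x := by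
    classical
    refine b.ext fun y => ?_
    rw [LinearMap.comp_apply, V.proj_of_mem (hb y)]
    split_ifs with h
    · rfl
    · have hxy : y ≠ x := fun e => h (by rw [e])
      rw [map_zero, Module.Basis.coord_apply, Module.Basis.repr_self,
        Finsupp.single_eq_of_ne hxy.symm]
  rw [← h, LinearMap.comp_apply, V.proj_of_mem hv, if_neg ha.symm, map_zero]

theorem tprod_line (a c : ZMod 2) (f : Fin n → k →ₗ[k] k) :
    (PiTensorProduct.tprod k f : TPow k n ((SVec.line k a).hom (SVec.line k c)))
      = (∏ i, f i 1) • PiTensorProduct.tprod k fun _ => (LinearMap.id : k →ₗ[k] k) := by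
  rw [← MultilinearMap.map_smul_univ]
  congr 1; funext i
  ext
  simp

theorem Gamma.eq_smul_id {c : ZMod 2}
    (t : Gamma n ((SVec.line k c).hom (SVec.line k c))) :
    ∃ x : k, t = x • Gamma.id n (SVec.line k c) := by
  obtain ⟨t, ht⟩ := t
  suffices h : ∃ x : k, t = x • PiTensorProduct.tprod k fun _ => (LinearMap.id : k →ₗ[k] k) by
    obtain ⟨x, hx⟩ := h
    exact ⟨x, Subtype.ext hx⟩
  clear ht
  induction t using PiTensorProduct.induction_on with
  | smul_tprod r f => exact ⟨r * ∏ i, f i 1, by rw [tprod_line, smul_smul]⟩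
  | add s t hs ht =>
    obtain ⟨x, rfl⟩ := hs
    obtain ⟨y, rfl⟩ := ht
    exact ⟨x + y, (add_smul _ _ _).symm⟩

/-- There are no nonzero invariants in the tensor powers of degree at least `2` of an odd line: an
exchange of two factors acts by `-1`. -/
theorem Gamma.eq_zero_of_odd_line (h2 : (2 : k) ≠ 0) (hn : 2 ≤ n) {a c : ZMod 2} (hac : a ≠ c)
    (t : Gamma n ((SVec.line k a).hom (SVec.line k c))) : t = 0 := by
  let i : Fin n := ⟨0, by omega⟩
  let j : Fin n := ⟨1, by omega⟩
  have hodd : ∀ f : k →ₗ[k] k, f ∈ ((SVec.line k a).hom (SVec.line k c)).gr 1 := by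
    intro f b x hx
    by_cases h : b = a
    · subst h
      have : b + 1 = c := (by decide : ∀ b c : ZMod 2, b ≠ c → b + 1 = c) b c hac
      rw [this]
      exact SVec.mem_line _ _
    · rw [SVec.eq_zero_of_mem_line h hx, map_zero]
      exact zero_mem _
  have h : signedSwap ((SVec.line k a).hom (SVec.line k c)) i j = -LinearMap.id := by
    refine PiTensorProduct.ext (MultilinearMap.ext fun f => ?_)
    change signedSwap _ i j (PiTensorProduct.tprod k f) = -PiTensorProduct.tprod k f
    rw [signedSwap_tprod _ i j (fun _ => 1) (fun l => hodd (f l)), tprod_line, tprod_line a c f,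
      Equiv.prod_comp (Equiv.swap i j) fun l => f l 1]
    simp
  have ht := t.2 i j rfl
  rw [h, LinearMap.neg_apply, LinearMap.id_apply, neg_eq_iff_add_eq_zero, ← two_smul k] at ht
  exact Subtype.ext ((smul_eq_zero.mp ht).resolve_left h2)

/-- A morphism from the line of parity `c` to `W`, followed by the tensor power of an even rank one
endomorphism of `W`, is a multiple of a tensor power `j ⊗ ⋯ ⊗ j`, where `j` sends `1` to a vector of
parity `c`. -/
theorem Gamma.exists_rankOne_comp_eq (h2 : (2 : k) ≠ 0) (hn : 2 ≤ n) {W : SVec k} {a c : ZMod 2}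
    {w : W} (hw : w ∈ W.gr a) {l : W →ₗ[k] k} (hl : ∀ b ≠ a, ∀ v ∈ W.gr b, l v = 0)
    (y : Gamma n ((SVec.line k c).hom W)) :
    ∃ (x : k) (w' : W.gr c),
      Gamma.comp (Gamma.powHom n (V := W) (W := W) (LinearMap.toSpanSingleton k W w ∘ₗ l)
        (SVec.comp_mem_even (SVec.toSpanSingleton_even hw) (SVec.form_even hl))) y
      = x • Gamma.powHom n _ (SVec.toSpanSingleton_even w'.2) := by
  rw [← Gamma.comp_powHom (SVec.toSpanSingleton_even hw) (SVec.form_even hl), Gamma.comp_assoc]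
  by_cases hac : c = a
  · subst hac
    obtain ⟨x, hx⟩ := Gamma.eq_smul_id (Gamma.comp (Gamma.powHom n l (SVec.form_even hl)) y)
    exact ⟨x, ⟨w, hw⟩, by rw [hx, Gamma.comp_smul, Gamma.comp_id]⟩
  · refine ⟨0, 0, ?_⟩
    rw [Gamma.eq_zero_of_odd_line h2 hn hac (Gamma.comp _ y), zero_smul]
    exact Subtype.ext (map_zero (compT _ _ _ _))

namespace StrictPolySuperfunctor

/-- A morphism from a line to `W` is, for all superfunctors that are additive on even maps at once,
a linear combination of tensor powers of even maps: the identity of `W` acts as the sum of the rank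
one idempotents of a homogeneous basis. -/
theorem exists_map_eq_sum (h2 : (2 : k) ≠ 0) (hn : 2 ≤ n) {W : SVec k} [FiniteDimensional k W]
    {c : ZMod 2} (y : Gamma n ((SVec.line k c).hom W)) :
    ∃ (X : Type u) (_ : Fintype X) (x : X → k) (w : X → W.gr c),
      ∀ A : StrictPolySuperfunctor k n, A.IsEvenAdditive →
        A.map y = ∑ i, x i • A.onEven _ (SVec.toSpanSingleton_even (w i).2) := by
  obtain ⟨X, b, q, hb⟩ := W.exists_homogeneous_basis
  have : Fintype X := FiniteDimensional.fintypeBasisIndex b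
  choose x w hxw using fun i =>
    Gamma.exists_rankOne_comp_eq h2 hn (hb i) (SVec.coord_eq_zero hb i) y
  refine ⟨X, inferInstance, x, w, fun A hA => ?_⟩
  have hid : (LinearMap.id : W →ₗ[k] W)
      = ∑ i, LinearMap.toSpanSingleton k W (b i) ∘ₗ b.coord i := by
    ext v
    simp [LinearMap.sum_apply, b.sum_repr]
  have e : ∀ i, LinearMap.toSpanSingleton k W (b i) ∘ₗ b.coord i ∈ (W.hom W).gr 0 := fun i =>
    SVec.comp_mem_even (SVec.toSpanSingleton_even (hb i))
      (SVec.form_even (SVec.coord_eq_zero hb i))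
  have h1 := hA.onEven_sum (by omega) Finset.univ e
  rw [← onEven_congr hid W.id_mem, onEven_id] at h1
  ext m
  have h3 := LinearMap.congr_fun h1 (A.map y m)
  rw [LinearMap.id_apply, LinearMap.sum_apply] at h3
  rw [h3, LinearMap.sum_apply]
  refine Finset.sum_congr rfl fun i _ => ?_
  rw [onEven, ← map_comp_apply, hxw i, map_smul]
  rfl

/-- The maps of a direct sum are jointly injective if a vector of a summand can be detected by a
linear form that vanishes on the other summands. -/
theorem _root_.StrictPoly.toModule_injective {ι : Type*} [DecidableEq ι] {M : ι → Type*}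
    [∀ i, AddCommGroup (M i)] [∀ i, Module k (M i)] {N : Type*} [AddCommGroup N] [Module k N]
    (η : ∀ i, M i →ₗ[k] N)
    (h : ∀ i (x : M i), x ≠ 0 →
      ∃ l : N →ₗ[k] k, (∀ j ≠ i, l ∘ₗ η j = 0) ∧ l (η i x) ≠ 0) :
    Function.Injective (DirectSum.toModule k ι N η) := by
  rw [← LinearMap.ker_eq_bot, LinearMap.ker_eq_bot']
  intro z hz
  refine DFinsupp.ext fun i => ?_
  by_contra hi
  obtain ⟨l, hl, hli⟩ := h i (z i) hi
  have e : l ∘ₗ DirectSum.toModule k ι N η = (l ∘ₗ η i) ∘ₗ DirectSum.component k ι M i := by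
    refine DirectSum.linearMap_ext _ fun j => LinearMap.ext fun x => ?_
    simp only [LinearMap.comp_apply, DirectSum.toModule_lof]
    by_cases hj : j = i
    · subst hj
      rw [DirectSum.component.lof_self]
    · rw [DirectSum.component.of, dif_neg hj, map_zero, map_zero]
      exact LinearMap.congr_fun (hl j hj) x
  have := LinearMap.congr_fun e z
  rw [LinearMap.comp_apply, hz, map_zero] at this
  exact hli this.symm

/-- The inverse of an even isomorphism is even. -/
theorem _root_.StrictPoly.SVec.symm_mem {V W : SVec k} (e : V ≃ₗ[k] W)
    (he : ∀ c, ∀ z ∈ V.gr c, e z ∈ W.gr c) {c : ZMod 2} {x : W} (hx : x ∈ W.gr c) :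
    e.symm x ∈ V.gr c := by
  have h : W.proj c ∘ₗ e.toLinearMap = e.toLinearMap ∘ₗ V.proj c := by
    refine SVec.hom_ext fun a v hv => ?_
    rw [LinearMap.comp_apply, LinearMap.comp_apply, V.proj_of_mem hv]
    refine (W.proj_of_mem (he a v hv) c).trans ?_
    split_ifs <;> simp
  have h1 := LinearMap.congr_fun h (e.symm x)
  simp only [LinearMap.comp_apply, LinearEquiv.coe_coe, LinearEquiv.apply_symm_apply,
    W.proj_of_mem hx, if_true] at h1
  rw [LinearEquiv.symm_apply_eq _ |>.mpr h1]
  exact V.proj_mem _ _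

/-- Even natural maps `Fᵢ → A` that present every `A(V)` as the direct sum of the `Fᵢ(V)` give an
isomorphism of superfunctors. -/
theorem nonempty_iso_directSum {ι : Type u} [DecidableEq ι] {A : StrictPolySuperfunctor k n}
    {F : ι → StrictPolySuperfunctor k n}
    (η : ∀ (i : ι) (V : SVec k) [FiniteDimensional k V], (F i).obj V →ₗ[k] A.obj V)
    (even : ∀ (i : ι) (V : SVec k) [FiniteDimensional k V] (c : ZMod 2),
      ∀ x ∈ ((F i).obj V).gr c, η i V x ∈ (A.obj V).gr c)
    (natural : ∀ (i : ι) {V W : SVec k} [FiniteDimensional k V] [FiniteDimensional k W]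
      (t : Gamma n (V.hom W)) (x : (F i).obj V), η i W ((F i).map t x) = A.map t (η i V x))
    (bij : ∀ (V : SVec k) [FiniteDimensional k V],
      Function.Bijective (DirectSum.toModule k ι (A.obj V) fun i => η i V)) :
    Nonempty (A.Iso (.directSum F)) := by
  let Φ : ∀ (V : SVec k) [FiniteDimensional k V],
      (SVec.directSum fun i => (F i).obj V) ≃ₗ[k] A.obj V :=
    fun V _ => LinearEquiv.ofBijective (DirectSum.toModule k ι (A.obj V) fun i => η i V) (bij V)
  have hΦ : ∀ (V : SVec k) [FiniteDimensional k V] (c : ZMod 2)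
      (z : SVec.directSum fun i => (F i).obj V),
      z ∈ (SVec.directSum fun i => (F i).obj V).gr c → Φ V z ∈ (A.obj V).gr c := by
    intro V _ c z hz
    change DirectSum.toModule k ι (A.obj V) (fun i => η i V) z ∈ _
    classical
    rw [← DirectSum.sum_support_of z, map_sum]
    refine Submodule.sum_mem _ fun i _ => ?_
    have := DirectSum.toModule_lof k (φ := fun i => η i V) i (z i)
    rw [DirectSum.lof_eq_of] at this
    rw [this]
    exact even i V c _ (hz i)
  refine ⟨⟨fun V _ => (Φ V).symm, fun V _ c x hx => ?_, fun {V W} _ _ t x => ?_⟩⟩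
  · exact SVec.symm_mem (V := SVec.directSum fun i => (F i).obj V) (Φ V) (hΦ V) hx
  · obtain ⟨z, rfl⟩ := (Φ V).surjective x
    have : A.map t ∘ₗ DirectSum.toModule k ι (A.obj V) (fun i => η i V)
        = DirectSum.toModule k ι (A.obj W) (fun i => η i W) ∘ₗ
          DirectSum.lmap fun i => (F i).map t := by
      refine DirectSum.linearMap_ext _ fun i => LinearMap.ext fun y => ?_
      simp only [LinearMap.comp_apply, DirectSum.toModule_lof, DirectSum.lmap_lof]
      exact (natural i t y).symm
    exact (LinearEquiv.symm_apply_eq (Φ W)).mpr ((LinearMap.congr_fun this z).trans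
      (congrArg (fun y => Φ W ((directSum F).map t y)) ((Φ V).symm_apply_apply z).symm))

end StrictPolySuperfunctor

end StrictPoly

/-! ### Degree one -/

namespace StrictPoly

variable {k : Type u} [Field k]

/-- The canonical identification of `Hom(V, W)` with `Γ¹ Hom(V, W)`. -/
noncomputable def Gamma.ofHom (V W : SVec k) : (V →ₗ[k] W) →ₗ[k] Gamma 1 (V.hom W) :=
  LinearMap.codRestrict (Gamma 1 (V.hom W))
    (PiTensorProduct.subsingletonEquiv (R := k) (s := fun _ => V.hom W)
      (0 : Fin 1)).symm.toLinearMap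
    fun _ i j h => by omega

theorem Gamma.coe_ofHom {V W : SVec k} (f : V →ₗ[k] W) :
    (Gamma.ofHom V W f : TPow k 1 (V.hom W)) = PiTensorProduct.tprod k fun _ => f := by
  refine (LinearEquiv.symm_apply_eq _).mpr ?_
  simp

namespace StrictPolySuperfunctor

theorem fromOne_injective (V : SVec k) : Function.Injective (fromOne V) :=
  (PiTensorProduct.subsingletonEquiv (R := k) (s := fun _ => V) (0 : Fin 1)).injective

variable {A : StrictPolySuperfunctor k 1}

theorem map_ofHom_id (V : SVec k) [FiniteDimensional k V] :
    A.map (Gamma.ofHom V V LinearMap.id) = LinearMap.id := by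
  rw [← A.map_id V]
  exact congrArg A.map (Subtype.ext (Gamma.coe_ofHom _))

theorem map_map_ofHom {U V W : SVec k} [FiniteDimensional k U] [FiniteDimensional k V]
    [FiniteDimensional k W] (t : Gamma 1 (V.hom W)) (f : U →ₗ[k] V) (a : A.obj U) :
    A.map t (A.map (Gamma.ofHom U V f) a)
      = A.map (Gamma.ofHom U W ((fromOne (V.hom W) t : V →ₗ[k] W) ∘ₗ f)) a := by
  rw [← map_comp_apply]
  congr 2
  refine Subtype.ext (fromOne_injective _ ?_)
  rw [Gamma.coe_comp, fromOne_compT, Gamma.coe_ofHom, Gamma.coe_ofHom, fromOne_tprod,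
    fromOne_tprod]

/-- For `m ∈ A(k)`, the map `v ↦ A(j_v)(m)`, where `j_v : k → V` sends `1` to `v`. -/
noncomputable def evalVector (m : A.obj (SVec.line k 0)) (V : SVec k) [FiniteDimensional k V] :
    V →ₗ[k] A.obj V where
  toFun v := A.map (Gamma.ofHom (SVec.line k 0) V (LinearMap.toSpanSingleton k V v)) m
  map_add' v w := by
    have : LinearMap.toSpanSingleton k V (v + w)
        = LinearMap.toSpanSingleton k V v + LinearMap.toSpanSingleton k V w := by ext; simp
    rw [this, map_add, map_add]; rfl
  map_smul' c v := by
    have : LinearMap.toSpanSingleton k V (c • v) = c • LinearMap.toSpanSingleton k V v := by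
      ext; simp
    rw [this, map_smul, map_smul]; rfl

theorem evalVector_apply (m : A.obj (SVec.line k 0)) (V : SVec k) [FiniteDimensional k V] (v : V) :
    evalVector m V v
      = A.map (Gamma.ofHom (SVec.line k 0) V (LinearMap.toSpanSingleton k V v)) m := rfl

theorem map_evalVector {V W : SVec k} [FiniteDimensional k V] [FiniteDimensional k W]
    (t : Gamma 1 (V.hom W)) (m : A.obj (SVec.line k 0)) (v : V) :
    A.map t (evalVector m V v) = evalVector m W ((fromOne (V.hom W) t : V →ₗ[k] W) v) := by
  rw [evalVector_apply, map_map_ofHom, evalVector_apply]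
  congr 3
  ext
  simp

theorem evalVector_mem {m : A.obj (SVec.line k 0)} {q : ZMod 2}
    (hm : m ∈ (A.obj (SVec.line k 0)).gr q) {V : SVec k} [FiniteDimensional k V] {a : ZMod 2}
    {v : V} (hv : v ∈ V.gr a) : evalVector m V v ∈ (A.obj V).gr (q + a) := by
  have h : (Gamma.ofHom (SVec.line k 0) V (LinearMap.toSpanSingleton k V v)).1
      ∈ tensorGr 1 ((SVec.line k 0).hom V) a := by
    rw [Gamma.coe_ofHom]
    exact Submodule.subset_span ⟨fun _ => a, _,
      fun _ => SVec.toSpanSingleton_mem 0 (by rwa [zero_add]), by simp, rfl⟩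
  exact A.map_even a _ h q m hm

/-- A linear form `l` on `V` recovers `l(v) m` from the vector `A(j_v)(m)`. -/
theorem map_ofHom_evalVector {V : SVec k} [FiniteDimensional k V] (l : V →ₗ[k] k)
    (m : A.obj (SVec.line k 0)) (v : V) :
    A.map (Gamma.ofHom V (SVec.line k 0) l) (evalVector m V v) = l v • m := by
  rw [evalVector_apply, map_map_ofHom, Gamma.coe_ofHom, fromOne_tprod]
  have : l ∘ₗ LinearMap.toSpanSingleton k V v = l v • LinearMap.id := by
    ext; simp
  rw [this, map_smul, map_smul, map_ofHom_id]
  rfl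

/-- An identification of a superfunctor of degree `1` with the identity superfunctor whose parities
are shifted by `q`; it commutes with all morphisms without sign. -/
structure LinearModel (G : StrictPolySuperfunctor k 1) (q : ZMod 2) where
  equiv : ∀ (V : SVec k) [FiniteDimensional k V], G.obj V ≃ₗ[k] V
  mem : ∀ (V : SVec k) [FiniteDimensional k V] (c : ZMod 2) (x : G.obj V),
    x ∈ (G.obj V).gr c → equiv V x ∈ V.gr (c + q)
  natural : ∀ {V W : SVec k} [FiniteDimensional k V] [FiniteDimensional k W]
    (t : Gamma 1 (V.hom W)) (x : G.obj V),
    equiv W (G.map t x) = (fromOne (V.hom W) t : V →ₗ[k] W) (equiv V x)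

/-- The tautological identification of `𝐈` with itself. -/
noncomputable def LinearModel.identity (k : Type u) [Field k] :
    LinearModel (StrictPolySuperfunctor.identity k) 0 where
  equiv V _ := LinearEquiv.refl k V
  mem V _ c x hx := by rw [add_zero]; exact hx
  natural _ _ := rfl

theorem sg_sg (V : SVec k) (v : V) : sg V (sg V v) = v := by
  have : sg V ∘ₗ sg V = LinearMap.id := by
    refine SVec.hom_ext fun a v hv => ?_
    rw [LinearMap.comp_apply, sg_of_mem V hv, map_smul, sg_of_mem V hv, smul_smul, sgn_mul_self,
      one_smul, LinearMap.id_apply]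
  exact LinearMap.congr_fun this v

theorem sg_piHom {V W : SVec k} (f : V →ₗ[k] W) (v : V) :
    sg W ((piHom V W f : V →ₗ[k] W) v) = f (sg V v) := by
  have : LinearMap.compRight k (sg W) ∘ₗ (piHom V W : (V →ₗ[k] W) →ₗ[k] V →ₗ[k] W)
      = LinearMap.lcomp k W (sg V) := by
    refine SVec.hom_ext (V := V.hom W) fun c f hf => SVec.hom_ext (V := V) fun a v hv => ?_
    change sg W ((piHom V W f : V →ₗ[k] W) v) = f (sg V v)
    rw [piHom_of_mem V W hf, sg_of_mem V hv, LinearMap.smul_apply, map_smul, map_smul,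
      sg_of_mem W (hf a v hv), smul_smul, sgn_add, mul_left_comm, sgn_mul_self, mul_one]
  exact LinearMap.congr_fun (LinearMap.congr_fun this f) v

/-- The sign `v ↦ (-1)^{|v|} v` removes the sign in the action of `𝚷`. -/
noncomputable def LinearModel.parityChange (k : Type u) [Field k] :
    LinearModel (StrictPolySuperfunctor.parityChange k) 1 where
  equiv V _ := LinearEquiv.ofInvolutive (sg V) (sg_sg V)
  mem V _ c x hx := by
    change sg V x ∈ V.gr (c + 1)
    rw [sg_of_mem V hx]
    exact Submodule.smul_mem _ _ hx
  natural {V W} _ _ t x := sg_piHom (V := V) (W := W) (fromOne (V.hom W) t) x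

/-- A superfunctor of degree `1` is a direct sum of copies of `𝐈` and `𝚷`, one for each vector of
a homogeneous basis of `A(k)`. -/
theorem exists_iso_directSum_degree_one (A : StrictPolySuperfunctor k 1) :
    ∃ (ι : Type u) (G : ι → StrictPolySuperfunctor k 1),
      (∀ i, G i = .identity k ∨ G i = .parityChange k) ∧
      (A.HasFiniteDimensionalValues → Finite ι) ∧ Nonempty (A.Iso (.directSum G)) := by
  classical
  obtain ⟨X, b, q, hb⟩ := (A.obj (SVec.line k 0)).exists_homogeneous_basis
  have hG : ∀ x : X, ∃ G : StrictPolySuperfunctor k 1,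
      (G = .identity k ∨ G = .parityChange k) ∧ Nonempty (LinearModel G (q x)) := by
    intro x
    rcases zmod2_cases (q x) with h | h <;> rw [h]
    · exact ⟨_, Or.inl rfl, ⟨.identity k⟩⟩
    · exact ⟨_, Or.inr rfl, ⟨.parityChange k⟩⟩
  choose G hG E using hG
  replace E := fun x => (E x).some
  refine ⟨X, G, hG, fun h => ?_, ?_⟩
  · have := h (SVec.line k 0)
    exact Module.Finite.finite_basis b
  refine nonempty_iso_directSum
    (fun x V _ => evalVector (b x) V ∘ₗ ((E x).equiv V).toLinearMap) (fun x V _ c g hg => ?_)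
    (fun x {V W} _ _ t g => ?_) fun V _ => ⟨toModule_injective _ fun x g hg => ?_, fun a => ?_⟩
  · have := evalVector_mem (hb x) ((E x).mem V c g hg)
    rwa [(by decide : ∀ q c : ZMod 2, q + (c + q) = c)] at this
  · change evalVector (b x) W ((E x).equiv W ((G x).map t g)) = _
    rw [(E x).natural]
    exact (map_evalVector t (b x) _).symm
  · obtain ⟨l, hl⟩ : ∃ l : V →ₗ[k] k, l ((E x).equiv V g) ≠ 0 := by
      by_contra! h
      exact hg (((E x).equiv V).map_eq_zero_iff.mp
        ((Module.forall_dual_apply_eq_zero_iff k _).mp h))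
    have key : ∀ (y : X) (v : V),
        (b.coord x ∘ₗ A.map (Gamma.ofHom V (SVec.line k 0) l)) (evalVector (b y) V v)
          = l v * b.repr (b y) x := fun y v => by
      refine (congrArg (b.coord x) (map_ofHom_evalVector l (b y) v)).trans ?_
      rw [map_smul, smul_eq_mul, Module.Basis.coord_apply]
    refine ⟨b.coord x ∘ₗ A.map (Gamma.ofHom V (SVec.line k 0) l), fun y hy => ?_, ?_⟩
    · refine LinearMap.ext fun g' => (key y _).trans ?_
      rw [b.repr_self, Finsupp.single_eq_of_ne hy.symm, mul_zero]
      rfl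
    · refine (key x _).trans_ne ?_
      rw [b.repr_self, Finsupp.single_eq_same, mul_one]
      exact hl
  · let e := Module.finBasis k V
    have hid : (LinearMap.id : V →ₗ[k] V)
        = ∑ j, LinearMap.toSpanSingleton k V (e j) ∘ₗ e.coord j := by
      ext v
      simp [LinearMap.sum_apply, e.sum_repr]
    have ha : a = ∑ j, A.map (Gamma.ofHom V V
        (LinearMap.toSpanSingleton k V (e j) ∘ₗ e.coord j)) a := by
      conv_lhs => rw [← LinearMap.id_apply (R := k) a, ← map_ofHom_id V, hid, map_sum, map_sum]
      rw [LinearMap.sum_apply]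
    rw [← LinearMap.mem_range, ha]
    refine Submodule.sum_mem _ fun j _ => ?_
    have hj := map_map_ofHom (A := A) (Gamma.ofHom (SVec.line k 0) V
      (LinearMap.toSpanSingleton k V (e j))) (e.coord j) a
    rw [Gamma.coe_ofHom, fromOne_tprod] at hj
    rw [← hj, ← b.linearCombination_repr (A.map (Gamma.ofHom V (SVec.line k 0) (e.coord j)) a),
      Finsupp.linearCombination_apply, Finsupp.sum, map_sum]
    refine Submodule.sum_mem _ fun x _ => ?_
    rw [map_smul]
    refine Submodule.smul_mem _ _ ⟨DirectSum.lof k X (fun x => (G x).obj V) x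
      (((E x).equiv V).symm (e j)), ?_⟩
    rw [DirectSum.toModule_lof]
    simp [evalVector_apply]

end StrictPolySuperfunctor

end StrictPoly

/-! ### Degree a positive power of the characteristic -/

namespace StrictPoly

variable {k : Type u} [Field k] (p r : ℕ) [Fact p.Prime] [CharP k p]

theorem twistMor_powHom {V W : SVec k} [FiniteDimensional k V] [FiniteDimensional k W]
    (f : V →ₗ[k] W) (hf : f ∈ (V.hom W).gr 0) :
    twistMor p r (Gamma.powHom (p ^ r) f hf) = FrobTwist.map p r f := by
  refine (congrArg (FrobTwist.homMap p r) (iSharp_pow p r (V.hom W) f hf)).trans ?_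
  exact FrobTwist.homMap_mk f

theorem FrobTwist.map_add {V W : Type u} [AddCommGroup V] [Module k V] [AddCommGroup W]
    [Module k W] (f g : V →ₗ[k] W) :
    FrobTwist.map p r (f + g) = FrobTwist.map p r f + FrobTwist.map p r g :=
  FrobTwist.hom_ext fun v => by
    rw [LinearMap.add_apply, FrobTwist.map_mk, FrobTwist.map_mk, FrobTwist.map_mk,
      LinearMap.add_apply, FrobTwist.mk_add]

namespace StrictPolySuperfunctor

theorem frobTwist_isEvenAdditive (hp : 3 ≤ p) (hr : 0 < r) :
    (frobTwist k p r hp hr).IsEvenAdditive := by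
  intro V W _ _ f g hf hg
  refine (twistMor_powHom p r _ _).trans ((FrobTwist.map_add p r f g).trans ?_)
  exact (congrArg₂ (· + ·) (twistMor_powHom p r f hf) (twistMor_powHom p r g hg)).symm

variable {A : StrictPolySuperfunctor k (p ^ r)}

/-- For `m ∈ A(k)`, where `k` is placed in parity `c`, the linear map `V^{(r)} → A(V)` that sends
`v^{(r)}` to `A(j ⊗ ⋯ ⊗ j)(m)`, where `j : k → V` sends `1` to the component of `v` of
parity `c`. -/
noncomputable def evalTwist (hE : A.IsEvenAdditive) {c : ZMod 2} (m : A.obj (SVec.line k c))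
    (V : SVec k) [FiniteDimensional k V] : FrobTwist k p r V →ₗ[k] A.obj V :=
  FrobTwist.lift
    (AddMonoidHom.mk' (fun v => A.onEven _ (SVec.toSpanSingleton_even (V.proj_mem c v)) m)
      fun v w => by
        have := hE _ _ _ _ (SVec.toSpanSingleton_even (V.proj_mem c v))
          (SVec.toSpanSingleton_even (V.proj_mem c w))
        rw [← LinearMap.add_apply, ← this]
        refine LinearMap.congr_fun (onEven_congr ?_ _) m
        ext
        simp)
    fun a v => by
      change A.onEven _ _ m = a ^ p ^ r • A.onEven _ _ m
      rw [← LinearMap.smul_apply, ← onEven_smul]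
      refine LinearMap.congr_fun (onEven_congr ?_ _) m
      ext
      simp

variable (hE : A.IsEvenAdditive) {c : ZMod 2} (m : A.obj (SVec.line k c))
  {V W : SVec k} [FiniteDimensional k V] [FiniteDimensional k W]

theorem evalTwist_mk {v : V} (hv : v ∈ V.gr c) :
    evalTwist p r hE m V (FrobTwist.mk k p r v)
      = A.onEven _ (SVec.toSpanSingleton_even hv) m := by
  refine (FrobTwist.lift_mk _ _ _).trans (LinearMap.congr_fun (onEven_congr ?_ _) m)
  rw [V.proj_of_mem hv, if_pos rfl]

theorem map_evalTwist (hp : 3 ≤ p) (hr : 0 < r) (t : Gamma (p ^ r) (V.hom W))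
    {x : FrobTwist k p r V} (hx : x ∈ (V.twist p r).gr c) :
    A.map t (evalTwist p r hE m V x) = evalTwist p r hE m W (twistMor p r t x) := by
  have h2 : (2 : k) ≠ 0 := by
    have := (CharP.cast_eq_zero_iff k p 2).not.mpr fun h =>
      absurd (Nat.le_of_dvd (by norm_num) h) (by omega)
    exact_mod_cast this
  have hn : 2 ≤ p ^ r := (by omega : 2 ≤ p).trans (Nat.le_self_pow hr.ne' p)
  induction hx using Submodule.span_induction with
  | mem x hx =>
    obtain ⟨v, hv, rfl⟩ := hx
    -- Both sides only depend on the composite of `t` with the inclusion of the line through `v`.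
    obtain ⟨X, _, a, w, h⟩ := exists_map_eq_sum h2 hn
      (Gamma.comp t (Gamma.powHom (p ^ r) _ (SVec.toSpanSingleton_even hv)))
    have h1 := LinearMap.congr_fun (h A hE) m
    have h3 := LinearMap.congr_fun (h _ (frobTwist_isEvenAdditive p r hp hr))
      (FrobTwist.mk k p r (1 : k))
    rw [map_comp_apply] at h1
    have h4 : twistMor p r (Gamma.powHom (p ^ r) _ (SVec.toSpanSingleton_even hv))
        (FrobTwist.mk k p r (1 : k)) = FrobTwist.mk k p r v := by
      rw [twistMor_powHom, FrobTwist.map_mk, LinearMap.toSpanSingleton_apply, one_smul]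
    have h5 : twistMor p r t (FrobTwist.mk k p r v)
        = ∑ i, a i • FrobTwist.mk k p r (w i : W) := by
      rw [← h4]
      refine (map_comp_apply (A := frobTwist k p r hp hr) t _ _).symm.trans (h3.trans
        ((LinearMap.sum_apply _ _ _).trans (Finset.sum_congr rfl fun i _ => ?_)))
      refine congrArg (fun z : FrobTwist k p r W => a i • z)
        ((LinearMap.congr_fun (twistMor_powHom p r _ _) _).trans ?_)
      rw [FrobTwist.map_mk, LinearMap.toSpanSingleton_apply, one_smul]
    rw [evalTwist_mk p r hE m hv, h5, map_sum]
    refine h1.trans ((LinearMap.sum_apply _ _ _).trans (Finset.sum_congr rfl fun i _ => ?_))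
    rw [map_smul, evalTwist_mk p r hE m (w i).2]
    rfl
  | zero => simp
  | add x y _ _ hx hy => simp only [map_add, hx, hy]
  | smul a x _ hx => simp only [map_smul, hx]

theorem evalTwist_mem {m : A.obj (SVec.line k c)} {q : ZMod 2}
    (hm : m ∈ (A.obj (SVec.line k c)).gr q) (x : FrobTwist k p r V) :
    evalTwist p r hE m V x ∈ (A.obj V).gr q := by
  induction x using FrobTwist.induction with
  | h0 => rw [map_zero]; exact zero_mem _
  | h1 a v =>
    rw [map_smul]
    refine Submodule.smul_mem _ _ ?_
    rw [evalTwist, FrobTwist.lift_mk]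
    exact onEven_mem _ hm
  | h2 x y hx hy => rw [map_add]; exact add_mem hx hy

/-- A homogeneous linear form `l` on `V` recovers `l^{(r)}(x) m` from the image of `x`. -/
theorem onEven_evalTwist {l : V →ₗ[k] k} (hl : ∀ a ≠ c, ∀ v ∈ V.gr a, l v = 0)
    {x : FrobTwist k p r V} (hx : x ∈ (V.twist p r).gr c) :
    A.onEven l (SVec.form_even hl) (evalTwist p r hE m V x) = FrobTwist.form p r l x • m := by
  induction hx using Submodule.span_induction with
  | mem x hx =>
    obtain ⟨v, hv, rfl⟩ := hx
    have : l ∘ₗ LinearMap.toSpanSingleton k V v = l v • LinearMap.id := by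
      ext; simp
    rw [evalTwist_mk p r hE m hv, FrobTwist.form_mk]
    refine (onEven_onEven this (Submodule.smul_mem _ _ (SVec.id_mem (SVec.line k c))) m).trans ?_
    rw [onEven_smul (l v) (SVec.id_mem (SVec.line k c)), onEven_id]
    rfl
  | zero => simp
  | add x y _ _ hx hy => simp only [map_add, hx, hy, add_smul]
  | smul a x _ hx => simp only [map_smul, hx, smul_eq_mul, mul_smul]

/-- A homogeneous linear form `l` kills the image of the component of the other parity. -/
theorem onEven_evalTwist_of_ne {a : ZMod 2} (hac : a ≠ c) {l : V →ₗ[k] k}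
    (hl : ∀ b ≠ a, ∀ v ∈ V.gr b, l v = 0)
    {x : FrobTwist k p r V} (hx : x ∈ (V.twist p r).gr c) :
    A.onEven l (SVec.form_even hl) (evalTwist p r hE m V x) = 0 := by
  induction hx using Submodule.span_induction with
  | mem x hx =>
    obtain ⟨v, hv, rfl⟩ := hx
    have : l ∘ₗ LinearMap.toSpanSingleton k V v = 0 := by
      ext; simp [hl c hac.symm v hv]
    rw [evalTwist_mk p r hE m hv]
    refine (onEven_onEven (U := SVec.line k c) (W := SVec.line k a) this (zero_mem _) m).trans ?_
    rw [onEven_zero (pow_ne_zero _ (Fact.out : p.Prime).ne_zero)]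
    rfl
  | zero => simp
  | add x y _ _ hx hy => simp only [map_add, hx, hy, add_zero]
  | smul a x _ hx => simp only [map_smul, hx, smul_zero]

/-- An identification of a superfunctor with `V ↦ V_c^{(r)}`, placed in parity `q`. -/
structure TwistModel (G : StrictPolySuperfunctor k (p ^ r)) (c q : ZMod 2) where
  equiv : ∀ (V : SVec k) [FiniteDimensional k V], G.obj V ≃ₗ[k] (V.twist p r).gr c
  mem : ∀ (V : SVec k) [FiniteDimensional k V] (x : G.obj V), x ∈ (G.obj V).gr q
  natural : ∀ {V W : SVec k} [FiniteDimensional k V] [FiniteDimensional k W]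
    (t : Gamma (p ^ r) (V.hom W)) (x : G.obj V),
    (equiv W (G.map t x) : FrobTwist k p r W) = twistMor p r t (equiv V x : FrobTwist k p r V)

/-- The value of `𝐈_c^{(r)}` at `V` is `V_c^{(r)}` by definition, placed in parity `c`. -/
noncomputable def TwistModel.frobPart (hp : 3 ≤ p) (hr : 0 < r) (c : ZMod 2) :
    TwistModel p r (frobPart k p r hp hr c) c c where
  equiv V _ := LinearEquiv.refl k ((V.twist p r).gr c)
  mem V _ x := by
    change x ∈ (if c = c then ⊤ else ⊥ : Submodule k ((V.twist p r).gr c))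
    rw [if_pos rfl]
    trivial
  natural _ _ := rfl

theorem prodForm_map {n : ℕ} {E F : SVec k} (φ : E →ₗ[k] F) (l : Fin n → F →ₗ[k] k)
    (t : TPow k n E) :
    prodForm l (PiTensorProduct.map (fun _ => φ) t) = prodForm (fun i => l i ∘ₗ φ) t := by
  have : prodForm l ∘ₗ PiTensorProduct.map (fun _ => φ) = prodForm fun i => l i ∘ₗ φ := by
    refine PiTensorProduct.ext (MultilinearMap.ext fun v => ?_)
    simp
  exact LinearMap.congr_fun this t

/-- `𝐈^{(r)}` only sees the even part of a morphism, on which `𝚷` acts without sign. -/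
theorem twistMor_gammaPi (t : Gamma (p ^ r) (V.hom W)) :
    (twistMor p r (V := V.pi) (W := W.pi) (gammaPi t) :
      FrobTwist k p r V →ₗ[k] FrobTwist k p r W) = twistMor p r t := by
  refine FrobTwist.hom_ext fun v => FrobTwist.ext_form fun l => ?_
  refine (form_twistMor p r (V := V.pi) (W := W.pi) (gammaPi t) l v).trans
    (Eq.trans ?_ (form_twistMor p r t l v).symm)
  rw [gammaPi_coe, prodForm_map]
  congr 2; funext _
  refine SVec.hom_ext (V := V.hom W) fun a f hf => ?_
  rw [LinearMap.comp_apply, LinearMap.comp_apply, LinearMap.comp_apply,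
    SVec.proj_of_mem _ (piHom_mem V W hf), SVec.proj_of_mem _ hf, piHom_of_mem V W hf]
  split_ifs with h
  · subst h
    rw [sgn_zero, one_smul]; rfl
  · simp

/-- The composite `𝐈_{c+1}^{(r)} ∘ 𝚷` sends `V` to `(𝚷V)_{c+1}^{(r)} = V_c^{(r)}`,
placed in parity `c + 1`. -/
noncomputable def TwistModel.frobPartCompPi (hp : 3 ≤ p) (hr : 0 < r) (c : ZMod 2) :
    TwistModel p r (StrictPoly.frobPart k p r hp hr (c + 1)).compPi c (c + 1) where
  equiv V _ := LinearEquiv.ofEq ((V.pi.twist p r).gr (c + 1)) ((V.twist p r).gr c) <| by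
    change Submodule.span k (FrobTwist.mk k p r '' (V.gr (c + 1 + 1) : Set V)) = _
    rw [(by decide : ∀ c : ZMod 2, c + 1 + 1 = c) c]
  mem V _ x := by
    change x ∈ (if c + 1 = c + 1 then ⊤ else ⊥ : Submodule k ((V.pi.twist p r).gr (c + 1)))
    rw [if_pos rfl]
    trivial
  natural {V W} _ _ t x := LinearMap.congr_fun (twistMor_gammaPi p r t) x.1

/-- An additive superfunctor of degree `p^r`, `r > 0`, is a direct sum of copies of the four
twisted functors: for each parity `c`, every vector of a homogeneous basis of the value of `A` at
the line of parity `c` contributes one copy of `V ↦ V_c^{(r)}`, placed in the parity of that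
vector. -/
theorem IsAdditive.exists_iso_directSum_frobPart (hp : 3 ≤ p) (hr : 0 < r) (hA : A.IsAdditive) :
    ∃ (ι : Type u) (G : ι → StrictPolySuperfunctor k (p ^ r)),
      (∀ i, G i = frobPart k p r hp hr 0 ∨ G i = frobPart k p r hp hr 1 ∨
        G i = (frobPart k p r hp hr 0).compPi ∨ G i = (frobPart k p r hp hr 1).compPi) ∧
      (A.HasFiniteDimensionalValues → Finite ι) ∧ Nonempty (A.Iso (.directSum G)) := by
  classical
  have hn : p ^ r ≠ 0 := pow_ne_zero _ (Fact.out : p.Prime).ne_zero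
  have hE := hA.isEvenAdditive hn
  choose X b q hb using fun c => (A.obj (SVec.line k c)).exists_homogeneous_basis
  have hG : ∀ i : Σ c, X c, ∃ G : StrictPolySuperfunctor k (p ^ r),
      (G = frobPart k p r hp hr 0 ∨ G = frobPart k p r hp hr 1 ∨
        G = (frobPart k p r hp hr 0).compPi ∨ G = (frobPart k p r hp hr 1).compPi) ∧
      Nonempty (TwistModel p r G i.1 (q i.1 i.2)) := by
    rintro ⟨c, x⟩
    by_cases h : q c x = c
    · refine ⟨frobPart k p r hp hr c, ?_, ?_⟩
      · rcases zmod2_cases c with rfl | rfl <;> simp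
      · rw [h]
        exact ⟨.frobPart p r hp hr c⟩
    · refine ⟨(frobPart k p r hp hr (c + 1)).compPi, ?_, ?_⟩
      · rcases zmod2_cases c with rfl | rfl <;> simp [(by decide : (1 + 1 : ZMod 2) = 0)]
      · rw [(by decide : ∀ q c : ZMod 2, q ≠ c → q = c + 1) _ _ h]
        exact ⟨.frobPartCompPi p r hp hr c⟩
  choose G hG E using hG
  replace E := fun x => (E x).some
  refine ⟨Σ c, X c, G, hG, fun h => ?_, ?_⟩
  · have : ∀ c, Finite (X c) := fun c => by
      have := h (SVec.line k c)
      exact Module.Finite.finite_basis (b c)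
    infer_instance
  refine nonempty_iso_directSum
    (fun i V _ => evalTwist p r hE (b i.1 i.2) V ∘ₗ ((V.twist p r).gr i.1).subtype ∘ₗ
      ((E i).equiv V).toLinearMap) (fun i V _ c g hg => ?_)
    (fun i {V W} _ _ t g => ?_) fun V _ => ?_
  · by_cases hc : c = q i.1 i.2
    · subst hc
      exact evalTwist_mem p r hE (hb i.1 i.2) _
    · rw [SVec.eq_zero_of_mem _ hc hg ((E i).mem V g), map_zero]
      exact zero_mem _
  · refine (congrArg (evalTwist p r hE (b i.1 i.2) W) ((E i).natural t g)).trans ?_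
    exact (map_evalTwist p r hE _ hp hr t ((E i).equiv V g).2).symm
  obtain ⟨J, e, s, he⟩ := V.exists_homogeneous_basis
  have : Fintype J := FiniteDimensional.fintypeBasisIndex e
  have hcoord := SVec.coord_eq_zero he
  refine ⟨toModule_injective _ fun i g hg => ?_, fun a => ?_⟩
  · obtain ⟨c, x⟩ := i
    set z := (E ⟨c, x⟩).equiv V g with hz
    have hz0 : (z : FrobTwist k p r V) ≠ 0 := fun h =>
      hg (((E ⟨c, x⟩).equiv V).map_eq_zero_iff.mp (Subtype.ext h))
    obtain ⟨j, hj⟩ : ∃ j, FrobTwist.form p r (e.coord j) (z : FrobTwist k p r V) ≠ 0 := by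
      by_contra! h
      exact hz0 ((FrobTwist.eq_sum_basis e _).trans (Finset.sum_eq_zero fun j _ => by
        rw [h j, zero_smul]))
    -- A coordinate that does not vanish on `z` belongs to a basis vector of parity `c`.
    have hs : s j = c := by
      by_contra hne
      refine hj ?_
      have hle : (V.twist p r).gr c ≤ LinearMap.ker (FrobTwist.form p r (e.coord j)) := by
        refine Submodule.span_le.mpr ?_
        rintro _ ⟨v, hv, rfl⟩
        rw [SetLike.mem_coe, LinearMap.mem_ker, FrobTwist.form_mk, hcoord j c (Ne.symm hne) v hv,
          zero_pow hn]
      exact hle z.2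
    subst hs
    refine ⟨(b (s j)).coord x ∘ₗ A.onEven (e.coord j) (SVec.form_even (hcoord j)), ?_, ?_⟩
    · rintro ⟨c, y⟩ hy
      refine LinearMap.ext fun g' => ?_
      by_cases hc : c = s j
      · subst hc
        refine (congrArg ((b (s j)).coord x) (onEven_evalTwist p r hE _ (hcoord j)
          ((E ⟨s j, y⟩).equiv V g').2)).trans ?_
        rw [map_smul, Module.Basis.coord_apply, Module.Basis.repr_self,
          Finsupp.single_eq_of_ne (fun h => hy (by rw [h])), smul_zero]
        rfl
      · refine (congrArg ((b (s j)).coord x) (onEven_evalTwist_of_ne p r hE _ (Ne.symm hc)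
          (hcoord j) ((E ⟨c, y⟩).equiv V g').2)).trans ?_
        rw [map_zero]
        rfl
    · refine (congrArg ((b (s j)).coord x) (onEven_evalTwist p r hE _ (hcoord j)
          ((E ⟨s j, x⟩).equiv V g).2)).trans_ne ?_
      rw [map_smul, Module.Basis.coord_apply, Module.Basis.repr_self, Finsupp.single_eq_same,
        smul_eq_mul, mul_one]
      exact hj
  · have hid : (LinearMap.id : V →ₗ[k] V)
        = ∑ j, LinearMap.toSpanSingleton k V (e j) ∘ₗ e.coord j := by
      ext v
      simp [LinearMap.sum_apply, e.sum_repr]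
    have ha := LinearMap.congr_fun (hE.onEven_sum hn Finset.univ fun j => SVec.comp_mem_even
      (SVec.toSpanSingleton_even (he j)) (SVec.form_even (hcoord j))) a
    rw [← onEven_congr hid V.id_mem, onEven_id, LinearMap.id_apply, LinearMap.sum_apply] at ha
    rw [← LinearMap.mem_range, ha]
    refine Submodule.sum_mem _ fun j _ => ?_
    rw [← onEven_onEven rfl _ (hg := SVec.toSpanSingleton_even (he j))
      (hf := SVec.form_even (hcoord j)) a,
      ← (b (s j)).linearCombination_repr (A.onEven (e.coord j) (SVec.form_even (hcoord j)) a),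
      Finsupp.linearCombination_apply, Finsupp.sum, map_sum]
    refine Submodule.sum_mem _ fun x _ => ?_
    rw [map_smul]
    refine Submodule.smul_mem _ _ ⟨DirectSum.lof k (Σ c, X c) (fun i => (G i).obj V) ⟨s j, x⟩
      (((E ⟨s j, x⟩).equiv V).symm ⟨FrobTwist.mk k p r (e j),
        Submodule.subset_span ⟨_, he j, rfl⟩⟩), ?_⟩
    rw [DirectSum.toModule_lof]
    refine Eq.trans ?_ (evalTwist_mk p r hE _ (he j))
    simp

end StrictPolySuperfunctor

end StrictPoly

theorem mainTheorem2 (k : Type u) [Field k] (p : ℕ) [Fact p.Prime] [CharP k p] (hp : 3 ≤ p) :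
    (∀ (d : ℕ) (A : StrictPolySuperfunctor k d), A.IsAdditive → A.IsNonzero → ∃ r : ℕ, d = p ^ r) ∧
    (∀ A : StrictPolySuperfunctor k 1, A.IsAdditive →
      ∃ (ι : Type u) (G : ι → StrictPolySuperfunctor k 1),
        (∀ i, G i = .identity k ∨ G i = .parityChange k) ∧
        (A.HasFiniteDimensionalValues → Finite ι) ∧
        Nonempty (A.Iso (.directSum G))) ∧
    (∀ (r : ℕ) (hr : 0 < r) (A : StrictPolySuperfunctor k (p ^ r)), A.IsAdditive →
      ∃ (ι : Type u) (G : ι → StrictPolySuperfunctor k (p ^ r)),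
        (∀ i, G i = frobPart k p r hp hr 0 ∨ G i = frobPart k p r hp hr 1 ∨
          G i = (frobPart k p r hp hr 0).compPi ∨ G i = (frobPart k p r hp hr 1).compPi) ∧
        (A.HasFiniteDimensionalValues → Finite ι) ∧
        Nonempty (A.Iso (.directSum G))) := by
  refine ⟨fun d A hA hne => hA.exists_degree_eq p hne, fun A _ => ?_, fun r hr A hA => ?_⟩
  · exact StrictPolySuperfunctor.exists_iso_directSum_degree_one A
  · exact hA.exists_iso_directSum_frobPart p r hp hr
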